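/- Let $\mathcal P=\{(\mathbf u_i,\mathbf v_i): i=1,\dots,4\}$ be four point pairs, where each $\mathbf u_i$ and each $\mathbf v_i$ is the homogenization (by a last coordinate $1$) of a point of $\mathbb R^2$, the four $\mathbf u_i$ are pairwise distinct and the four $\mathbf v_i$ are pairwise distinct. In $\mathbb P^8=\mathbb P(\mathbb C^{3\times 3})$ let $\mathcal R_2=\{X:\operatorname{rank} X\le 2\}$, let $\mathcal L_{\mathcal P}=\{X:\mathbf v_i^\top X\mathbf u_i=0,\ i=1,\dots,4\}$, and call $\mathcal R_2\cap\mathcal L_{\mathcal P}$ the epipolar variety of $\mathcal P$. A linear subspace $C\subseteq\mathbb C^{3\times 3}$ whose matrices have maximal rank $k$ is a compression space (of rank at most $k$) if there are subspaces $V,W\subseteq\mathbb C^3$ with $\operatorname{codim}V+\dim W=k$ and $XV\subseteq W$ for all $X\in C$. 1. If for every triple of distinct indices $i,j,k$ the three points $\mathbf u_i,\mathbf u_j,\mathbf u_k$ are not collinear or the three points $\mathbf v_i,\mathbf v_j,\mathbf v_k$ are not collinear, then $\mathcal R_2\cap\mathcal L_{\mathcal P}$ is irreducible. 2. For arbitrary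 such $\mathcal P$, the variety $\mathcal R_2\cap\mathcal L_{\mathcal P}$ is reducible (a union of two proper closed subvarieties) if and only if $\mathcal L_{\mathcal P}\not\subseteq\mathcal R_2$ and $\mathcal L_{\mathcal P}$ contains a compression space of rank at most two that has codimension one in $\mathcal L_{\mathcal P}$. -/

import Mathlib

noncomputable section

namespace Epipolar

/-- The space of complex `3 × 3` matrices. -/
abbrev Mat3 : Type := Matrix (Fin 3) (Fin 3) ℂ

/-- The projective space `ℙ⁸ = ℙ(ℂ^{3 × 3})`. -/
abbrev P8 : Type := Projectivization ℂ Mat3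

/-- The value of a polynomial in the nine matrix entries at a matrix. -/
def evalMat (f : MvPolynomial (Fin 3 × Fin 3) ℂ) (X : Mat3) : ℂ :=
  MvPolynomial.eval (fun ij => X ij.1 ij.2) f

/-- The common projective zero locus of a set of polynomials. It is used for homogeneous
polynomials only, whose vanishing does not depend on the chosen representative. -/
def projZeroLocus (S : Set (MvPolynomial (Fin 3 × Fin 3) ℂ)) : Set P8 :=
  {x | ∀ f ∈ S, evalMat f x.rep = 0}

/-- Zariski closed subsets (projective subvarieties, possibly reducible) of `ℙ⁸`. -/
def IsProjClosed (Z : Set P8) : Prop :=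
  ∃ S : Set (MvPolynomial (Fin 3 × Fin 3) ℂ),
    (∀ f ∈ S, ∃ d : ℕ, f.IsHomogeneous d) ∧ Z = projZeroLocus S

theorem isProjClosed_empty : IsProjClosed ∅ := by
  refine ⟨{1}, ?_, ?_⟩
  · intro f hf
    rw [Set.mem_singleton_iff.1 hf]
    exact ⟨0, MvPolynomial.isHomogeneous_one _ _⟩
  · ext x
    simp [projZeroLocus, evalMat]

theorem isProjClosed_sInter (A : Set (Set P8)) (hA : ∀ Z ∈ A, IsProjClosed Z) :
    IsProjClosed (⋂₀ A) := by
  choose! S hS hZ using hA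
  refine ⟨⋃ Z ∈ A, S Z, ?_, ?_⟩
  · intro f hf
    simp only [Set.mem_iUnion] at hf
    obtain ⟨Z, hZA, hf⟩ := hf
    exact hS Z hZA f hf
  · ext x
    simp only [Set.mem_sInter, projZeroLocus, Set.mem_ofPred_eq, Set.mem_iUnion]
    constructor
    · rintro h f ⟨Z, hZA, hf⟩
      have := h Z hZA
      rw [hZ Z hZA] at this
      exact this f hf
    · intro h Z hZA
      rw [hZ Z hZA]
      exact fun f hf => h f ⟨Z, hZA, hf⟩

theorem isProjClosed_union (Y Z : Set P8) (hY : IsProjClosed Y) (hZ : IsProjClosed Z) :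
    IsProjClosed (Y ∪ Z) := by
  obtain ⟨S, hS, rfl⟩ := hY
  obtain ⟨T, hT, rfl⟩ := hZ
  refine ⟨{h | ∃ f ∈ S, ∃ g ∈ T, h = f * g}, ?_, ?_⟩
  · rintro h ⟨f, hf, g, hg, rfl⟩
    obtain ⟨d, hd⟩ := hS f hf
    obtain ⟨e, he⟩ := hT g hg
    exact ⟨d + e, hd.mul he⟩
  · ext x
    simp only [Set.mem_union, projZeroLocus, Set.mem_ofPred_eq]
    constructor
    · rintro (h | h) _ ⟨f, hf, g, hg, rfl⟩
      · simp only [evalMat, map_mul, mul_eq_zero]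
        exact Or.inl (h f hf)
      · simp only [evalMat, map_mul, mul_eq_zero]
        exact Or.inr (h g hg)
    · intro h
      by_contra hc
      push Not at hc
      obtain ⟨⟨f, hf, hfx⟩, ⟨g, hg, hgx⟩⟩ := hc
      have := h (f * g) ⟨f, hf, g, hg, rfl⟩
      simp only [evalMat, map_mul, mul_eq_zero] at this
      exact this.elim hfx hgx

/-- The Zariski topology on `ℙ⁸`. -/
abbrev zariskiTopology : TopologicalSpace P8 :=
  TopologicalSpace.ofClosed {Z | IsProjClosed Z} isProjClosed_empty
    (fun A hA => isProjClosed_sInter A hA) (fun Y hY Z hZ => isProjClosed_union Y Z hY hZ)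

/-- Irreducibility of a subset of `ℙ⁸` in the Zariski topology (non-emptiness included). -/
def IsIrreducibleVariety (Z : Set P8) : Prop :=
  @IsIrreducible P8 zariskiTopology Z

/-- A variety is reducible if it is the union of two proper closed subvarieties. -/
def IsReducibleVariety (Z : Set P8) : Prop :=
  ∃ Z₁ Z₂ : Set P8, IsProjClosed Z₁ ∧ IsProjClosed Z₂ ∧ Z₁ ⊂ Z ∧ Z₂ ⊂ Z ∧ Z = Z₁ ∪ Z₂

/-- The homogenization of a point of `ℝ²` by a last coordinate one, as a complex vector. -/
def homogenize (p : Fin 2 → ℝ) : Fin 3 → ℂ := ![(p 0 : ℂ), (p 1 : ℂ), 1]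

/-- The linear space of all matrices `X` that satisfy the epipolar equations
`vᵢᵀ X uᵢ = 0` of the point pairs `(uᵢ, vᵢ)`. -/
def epipolarSpace {k : ℕ} (u v : Fin k → Fin 2 → ℝ) : Submodule ℂ Mat3 where
  carrier := {X | ∀ i, homogenize (v i) ⬝ᵥ (X.mulVec (homogenize (u i))) = 0}
  add_mem' := by
    intro X Y hX hY i
    rw [Matrix.add_mulVec, dotProduct_add, hX i, hY i, add_zero]
  zero_mem' := by
    intro i
    rw [Matrix.zero_mulVec, dotProduct_zero]
  smul_mem' := by
    intro c X hX i
    rw [Matrix.smul_mulVec, dotProduct_smul, hX i, smul_zero]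

/-- The projective linear space `ℒ_𝒫 ⊆ ℙ⁸`. -/
def projEpipolarSpace {k : ℕ} (u v : Fin k → Fin 2 → ℝ) : Set P8 :=
  {x | x.rep ∈ epipolarSpace u v}

/-- The determinantal hypersurface `ℛ₂ ⊆ ℙ⁸` of matrices of rank at most two. -/
def rankAtMostTwo : Set P8 := {x | x.rep.rank ≤ 2}

/-- The epipolar variety `ℛ₂ ∩ ℒ_𝒫`. -/
def epipolarVariety {k : ℕ} (u v : Fin k → Fin 2 → ℝ) : Set P8 :=
  rankAtMostTwo ∩ projEpipolarSpace u v

/-- `C` is a compression space whose matrices have maximal rank `k`: there are numbers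
`k₁ + k₂ = k`, a subspace `V` of codimension `k₁` and a subspace `W` of dimension `k₂` such that
every `X ∈ C` maps `V` into `W`. -/
def IsCompressionSpace (C : Submodule ℂ Mat3) (k : ℕ) : Prop :=
  IsGreatest {r : ℕ | ∃ X ∈ C, X.rank = r} k ∧
    ∃ (k₁ k₂ : ℕ) (V W : Submodule ℂ (Fin 3 → ℂ)),
      k₁ + k₂ = k ∧ Module.finrank ℂ V + k₁ = 3 ∧ Module.finrank ℂ W = k₂ ∧
        ∀ X ∈ C, ∀ x ∈ V, X.mulVec x ∈ W

/-- `L` contains a compression space of rank at most two that has codimension one in `L`. -/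
def ContainsCodimOneCompressionSpace (L : Submodule ℂ Mat3) : Prop :=
  ∃ (C : Submodule ℂ Mat3) (k : ℕ), k ≤ 2 ∧ IsCompressionSpace C k ∧ C ≤ L ∧
    Module.finrank ℂ C + 1 = Module.finrank ℂ L

end Epipolar

end

namespace Epipolar

open MvPolynomial Module

/-! ### Homogeneous polynomials on the space of matrices -/

/-! On the epipolar space `L`, of dimension at least five, the epipolar variety is the zero locus of
the cubic form `det`. If it is reducible, the Nullstellensatz shows that this cubic generates a
non-prime ideal. So it is nonzero and splits as linear times quadratic, and `L` has a hyperplane `C`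
of singular matrices (`exists_singular_hyperplane_of_isReducibleVariety`).

The core is `exists_collinear_triple`: since `dim C ≥ 4`, some three pairs are collinear on both
sides. If some triple is a frame on both sides, the matrices of `C` become zero-diagonal in these
frames, and `det` is a sum of two products of three entries; its vanishing on so large a space
forces a doubly collinear triple. Otherwise every triple is collinear on some side. By pigeonhole
two triples are collinear on the same side, so all four points there are collinear while the other
side is in general position, which `not_cubic_relation` excludes.

Conversely, a doubly collinear triple gives frames in which `det` on `L` is visibly an entry times a
quadric. If `L` contains a regular matrix, this entry cuts out a compression hyperplane, and entry
and quadric cut out two proper closed pieces. Thus a reducible variety, a codimension-one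
compression space and a doubly collinear triple all coincide once `L` is not entirely singular. -/

theorem IsHomogeneous.eval_smul {σ R : Type*} [CommSemiring R] {f : MvPolynomial σ R} {d : ℕ}
    (hf : f.IsHomogeneous d) (c : R) (x : σ → R) : eval (c • x) f = c ^ d * eval x f := by
  rw [eval_eq, eval_eq, Finset.mul_sum]
  refine Finset.sum_congr rfl fun m hm => ?_
  have hd : ∑ i ∈ m.support, m i = d := (hf.degree_eq_sum_deg_support hm).symm
  simp only [Pi.smul_apply, smul_eq_mul, mul_pow, Finset.prod_mul_distrib,
    Finset.prod_pow_eq_pow_sum, hd]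
  ring

theorem evalMat_smul {f : MvPolynomial (Fin 3 × Fin 3) ℂ} {d : ℕ} (hf : f.IsHomogeneous d)
    (c : ℂ) (X : Mat3) : evalMat f (c • X) = c ^ d * evalMat f X :=
  IsHomogeneous.eval_smul hf c fun ij => X ij.1 ij.2

/-- A linear form on a coordinate space that is given by a homogeneous polynomial of degree one. -/
theorem exists_dual_of_isHomogeneous_one {σ : Type*} [Finite σ] {p : MvPolynomial σ ℂ}
    (hp : p.IsHomogeneous 1) : ∃ l : Dual ℂ (σ → ℂ), ∀ x, eval x p = l x := by
  have : p ∈ Submodule.span ℂ (Set.range (X : σ → MvPolynomial σ ℂ)) := by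
    rw [← homogeneousSubmodule_one_eq_span_X]; exact hp
  induction this using Submodule.span_induction with
  | mem x h => obtain ⟨i, rfl⟩ := h; exact ⟨LinearMap.proj i, fun x => by simp⟩
  | zero => exact ⟨0, fun x => by simp⟩
  | add p q hp hq h1 h2 =>
    obtain ⟨l, hl⟩ := h1 (by rwa [← mem_homogeneousSubmodule, homogeneousSubmodule_one_eq_span_X])
    obtain ⟨m, hm⟩ := h2 (by rwa [← mem_homogeneousSubmodule, homogeneousSubmodule_one_eq_span_X])
    exact ⟨l + m, fun x => by simp [hl, hm]⟩
  | smul c p hp h1 =>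
    obtain ⟨l, hl⟩ := h1 (by rwa [← mem_homogeneousSubmodule, homogeneousSubmodule_one_eq_span_X])
    exact ⟨c • l, fun x => by simp [smul_eval, hl]⟩

/-- The polynomial of a linear form on the space of matrices. -/
noncomputable def linearPoly (l : Dual ℂ Mat3) : MvPolynomial (Fin 3 × Fin 3) ℂ :=
  ∑ ij : Fin 3 × Fin 3, C (l (Matrix.single ij.1 ij.2 1)) * X ij

theorem evalMat_linearPoly (l : Dual ℂ Mat3) (X : Mat3) : evalMat (linearPoly l) X = l X := by
  conv_rhs => rw [Matrix.matrix_eq_sum_single X]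
  simp only [evalMat, linearPoly, map_sum, map_mul, eval_C, eval_X, Fintype.sum_prod_type]
  refine Finset.sum_congr rfl fun i _ => Finset.sum_congr rfl fun j _ => ?_
  rw [← mul_one (X i j), ← smul_eq_mul (X i j), ← Matrix.smul_single, map_smul]
  simp [mul_comm]

theorem isHomogeneous_linearPoly (l : Dual ℂ Mat3) : (linearPoly l).IsHomogeneous 1 :=
  IsHomogeneous.sum _ _ _ fun ij _ => (isHomogeneous_X ℂ ij).C_mul _

theorem evalMat_mul (f g : MvPolynomial (Fin 3 × Fin 3) ℂ) (X : Mat3) :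
    evalMat (f * g) X = evalMat f X * evalMat g X := by simp [evalMat]

/-- The determinant as a polynomial in the matrix entries. -/
noncomputable def detPoly : MvPolynomial (Fin 3 × Fin 3) ℂ := (Matrix.mvPolynomialX (Fin 3) (Fin 3) ℂ).det

theorem evalMat_detPoly (X : Mat3) : evalMat detPoly X = X.det := by
  simp [evalMat, detPoly, Matrix.det_fin_three]

theorem isHomogeneous_detPoly : detPoly.IsHomogeneous 3 := by
  have h (i j k l m n : Fin 3) : ((X (i, j) * X (k, l) * X (m, n) :
      MvPolynomial (Fin 3 × Fin 3) ℂ)).IsHomogeneous 3 :=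
    ((isHomogeneous_X ℂ _).mul (isHomogeneous_X ℂ _)).mul (isHomogeneous_X ℂ _)
  rw [detPoly, Matrix.det_fin_three]
  simp only [Matrix.mvPolynomialX_apply]
  exact (((((h ..).sub (h ..)).sub (h ..)).add (h ..)).add (h ..)).sub (h ..)

theorem rank_le_two_iff (X : Mat3) : X.rank ≤ 2 ↔ X.det = 0 := by
  refine ⟨fun h => ?_, fun h => ?_⟩
  · by_contra hX
    rw [X.rank_of_det_ne_zero hX, Fintype.card_fin] at h
    omega
  · obtain ⟨v, hv, hXv⟩ := Matrix.exists_mulVec_eq_zero_iff.2 h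
    have h1 := X.mulVecLin.finrank_range_add_finrank_ker
    have h2 : 0 < finrank ℂ (LinearMap.ker X.mulVecLin) := by
      have : Nontrivial (LinearMap.ker X.mulVecLin) :=
        ⟨⟨⟨v, by simpa using hXv⟩, 0, fun h => hv (congrArg Subtype.val h)⟩⟩
      exact finrank_pos
    rw [finrank_fin_fun] at h1
    have : X.rank = finrank ℂ (LinearMap.range X.mulVecLin) := rfl
    omega

/-! ### The variety of singular matrices in a linear space -/

/-- The projective variety of the singular matrices in a linear space of matrices. -/
def singularLocus (L : Submodule ℂ Mat3) : Set P8 := {x | x.rep ∈ L ∧ x.rep.det = 0}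

theorem epipolarVariety_eq {k : ℕ} (u v : Fin k → Fin 2 → ℝ) :
    epipolarVariety u v = singularLocus (epipolarSpace u v) := by
  ext x
  simp only [epipolarVariety, rankAtMostTwo, projEpipolarSpace, singularLocus, Set.mem_inter_iff,
    Set.mem_ofPred_eq, rank_le_two_iff]
  exact and_comm

theorem exists_rep_eq_smul {X : Mat3} (hX : X ≠ 0) :
    ∃ c : ℂ, c ≠ 0 ∧ (Projectivization.mk ℂ X hX).rep = c • X := by
  obtain ⟨a, ha⟩ := Projectivization.exists_smul_eq_mk_rep ℂ X hX
  exact ⟨a, a.ne_zero, ha.symm⟩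

theorem mk_mem_singularLocus {L : Submodule ℂ Mat3} {X : Mat3} (hX : X ≠ 0) (hL : X ∈ L)
    (hd : X.det = 0) : Projectivization.mk ℂ X hX ∈ singularLocus L := by
  obtain ⟨c, -, hc⟩ := exists_rep_eq_smul hX
  refine ⟨hc ▸ L.smul_mem c hL, ?_⟩
  rw [hc, Matrix.det_smul, hd, mul_zero]

theorem isProjClosed_setOf_evalMat {f : MvPolynomial (Fin 3 × Fin 3) ℂ} {d : ℕ}
    (hf : f.IsHomogeneous d) : IsProjClosed {x | evalMat f x.rep = 0} :=
  ⟨{f}, fun g hg => ⟨d, by rwa [Set.mem_singleton_iff.1 hg]⟩, by simp [projZeroLocus]⟩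

theorem IsProjClosed.inter {Y Z : Set P8} (hY : IsProjClosed Y) (hZ : IsProjClosed Z) :
    IsProjClosed (Y ∩ Z) := by
  rw [← Set.sInter_pair]
  exact isProjClosed_sInter _ (by rintro _ (rfl | rfl) <;> assumption)

theorem isProjClosed_singularLocus (L : Submodule ℂ Mat3) : IsProjClosed (singularLocus L) := by
  have h : singularLocus L = (⋂₀ {Z | ∃ l : Dual ℂ Mat3, l ∈ L.dualAnnihilator ∧
      Z = {x : P8 | evalMat (linearPoly l) x.rep = 0}}) ∩ {x | evalMat detPoly x.rep = 0} := by
    ext x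
    simp only [singularLocus, evalMat_linearPoly, evalMat_detPoly, Set.mem_ofPred_eq,
      Set.mem_inter_iff, Set.mem_sInter]
    refine and_congr_left fun _ => ⟨?_, fun h => ?_⟩
    · rintro hx _ ⟨l, hl, rfl⟩
      exact (Submodule.mem_dualAnnihilator l).1 hl _ hx
    · rw [← Subspace.forall_mem_dualAnnihilator_apply_eq_zero_iff]
      exact fun l hl => h _ ⟨l, hl, rfl⟩
  rw [h]
  refine (isProjClosed_sInter _ ?_).inter (isProjClosed_setOf_evalMat isHomogeneous_detPoly)
  rintro _ ⟨l, -, rfl⟩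
  exact isProjClosed_setOf_evalMat (isHomogeneous_linearPoly l)

theorem isIrreducibleVariety_of_not_isReducibleVariety {Z : Set P8} (hZ : IsProjClosed Z)
    (hne : Z.Nonempty) (h : ¬ IsReducibleVariety Z) : IsIrreducibleVariety Z := by
  refine ⟨hne, ?_⟩
  rw [@isPreirreducible_iff_isClosed_union_isClosed P8 zariskiTopology]
  intro Z₁ Z₂ h₁ h₂ hZZ
  have hcl {Y : Set P8} (hY : @IsClosed P8 zariskiTopology Y) : IsProjClosed Y :=
    compl_compl Y ▸ hY.isOpen_compl
  replace h₁ := hcl h₁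
  replace h₂ := hcl h₂
  by_contra! hc
  refine h ⟨Z ∩ Z₁, Z ∩ Z₂, hZ.inter h₁, hZ.inter h₂, ?_, ?_, ?_⟩
  · exact Set.inter_ssubset_left_iff.2 hc.1
  · exact Set.inter_ssubset_left_iff.2 hc.2
  · rw [← Set.inter_union_distrib_left, Set.inter_eq_left.2 hZZ]

/-- In a pencil spanned by `f 0` and `f 1` with `f 0` invertible, an eigenvalue `μ` of `(f 0)⁻¹ * f
1` makes `μ • f 0 - f 1` singular. -/
theorem singularLocus_nonempty {L : Submodule ℂ Mat3} (hL : 2 ≤ finrank ℂ L) :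
    (singularLocus L).Nonempty := by
  obtain ⟨f, hf⟩ := exists_linearIndependent_of_le_finrank hL
  have h0 : f 0 ≠ 0 := hf.ne_zero 0
  by_cases hd : (f 0 : Mat3).det = 0
  · exact ⟨_, mk_mem_singularLocus (by simpa using h0) (f 0).2 hd⟩
  · obtain ⟨μ, hμ⟩ := IsAlgClosed.exists_root (Matrix.charpoly ((f 0 : Mat3)⁻¹ * (f 1 : Mat3)))
      (by rw [Matrix.charpoly_degree_eq_dim]; simp)
    have hμ' : (μ • (1 : Mat3) - (f 0 : Mat3)⁻¹ * (f 1 : Mat3)).det = 0 := by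
      rw [Polynomial.IsRoot, Matrix.eval_charpoly] at hμ
      rwa [Matrix.smul_one_eq_diagonal]
    have hmul : (f 0 : Mat3) * (μ • (1 : Mat3) - (f 0 : Mat3)⁻¹ * (f 1 : Mat3)) =
        ((μ • f 0 - f 1 : L) : Mat3) := by
      rw [Matrix.mul_sub, Matrix.mul_nonsing_inv_cancel_left _ _ (Ne.isUnit hd)]
      simp
    refine ⟨_, mk_mem_singularLocus (X := ((μ • f 0 - f 1 : L) : Mat3)) ?_ (μ • f 0 - f 1).2 ?_⟩
    · intro h
      have h2 := Fintype.linearIndependent_iff.1 hf ![μ, -1] (by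
        rw [Fin.sum_univ_two]
        exact Subtype.ext (by simpa [sub_eq_add_neg] using h)) 1
      simp at h2
    · rw [← hmul, Matrix.det_mul, hμ', mul_zero]

/-! ### Reducible varieties of singular matrices contain a hyperplane -/

/-- If a cubic form on a coordinate space is not a prime polynomial and not zero, then it vanishes
on a hyperplane. -/
theorem exists_dual_of_not_prime_cubic {n : ℕ} {D : MvPolynomial (Fin n) ℂ}
    (hD : D.IsHomogeneous 3) (h0 : D ≠ 0) (hp : ¬ Prime D) :
    ∃ l : Dual ℂ (Fin n → ℂ), l ≠ 0 ∧ ∀ x, l x = 0 → eval x D = 0 := by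
  have key (g h : MvPolynomial (Fin n) ℂ) (hgh : D = g * h) (hg : g.totalDegree = 1)
      (hh : h.totalDegree = 2) :
      ∃ l : Dual ℂ (Fin n → ℂ), l ≠ 0 ∧ ∀ x, l x = 0 → eval x D = 0 := by
    obtain ⟨l, hl⟩ := exists_dual_of_isHomogeneous_one (homogeneousComponent_isHomogeneous 1 g)
    have hg' := sum_homogeneousComponent g
    have hh' := sum_homogeneousComponent h
    rw [hg, Finset.sum_range_succ, Finset.sum_range_one, homogeneousComponent_zero] at hg'
    rw [hh, Finset.sum_range_succ, Finset.sum_range_succ, Finset.sum_range_one] at hh'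
    refine ⟨l, ?_, fun x hx => ?_⟩
    · rintro rfl
      have : homogeneousComponent 1 g = 0 := funext fun x => by simp [hl]
      rw [this, add_zero] at hg'
      rw [← hg', totalDegree_C] at hg
      exact absurd hg (by norm_num)
    -- On `l x = 0` the factor `g` is constant along the line `t • x`, so a pure cubic in `t` equals
    -- a polynomial of degree at most two.
    · have hev (t : ℂ) : t ^ 3 * eval x D = coeff 0 g * (eval x (homogeneousComponent 0 h) +
          t * eval x (homogeneousComponent 1 h) + t ^ 2 * eval x (homogeneousComponent 2 h)) := by
        have h1 : eval (t • x) g = coeff 0 g := by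
          conv_lhs => rw [← hg']
          simp [hl, hx]
        have h2 := congrArg (eval (t • x)) hh'
        simp only [map_add,
          IsHomogeneous.eval_smul (homogeneousComponent_isHomogeneous 0 h),
          IsHomogeneous.eval_smul (homogeneousComponent_isHomogeneous 1 h),
          IsHomogeneous.eval_smul (homogeneousComponent_isHomogeneous 2 h)] at h2
        rw [← IsHomogeneous.eval_smul hD, hgh, map_mul, h1, ← h2]
        ring
      -- A third difference: these weights at `±1`, `±2` kill degrees at most two and send `t ^ 3`
      -- to one.
      linear_combination (1 / 12) * hev 2 - (1 / 12) * hev (-2) - (1 / 6) * hev 1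
        + (1 / 6) * hev (-1)
  have hirr : ¬ Irreducible D := fun h => hp h.prime
  have htd := hD.totalDegree h0
  have hun : ¬ IsUnit D := fun h => by
    have := (isUnit_iff_totalDegree_of_isReduced.1 h).2
    omega
  rw [irreducible_iff] at hirr
  push Not at hirr
  obtain ⟨g, h, hgh, hg, hh⟩ := hirr hun
  have hne : g ≠ 0 ∧ h ≠ 0 := by rw [← mul_ne_zero_iff, ← hgh]; exact h0
  have hpos {p : MvPolynomial (Fin n) ℂ} (hp0 : p ≠ 0) (hp : ¬ IsUnit p) : p.totalDegree ≠ 0 := by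
    intro hd
    rw [totalDegree_eq_zero_iff_eq_C] at hd
    refine hp (isUnit_iff_eq_C_of_isReduced.2 ⟨_, Ne.isUnit fun hc => hp0 ?_, hd⟩)
    rw [hd, hc, C_0]
  have h1 := hpos hne.1 hg
  have h2 := hpos hne.2 hh
  have h3 := totalDegree_mul_of_isDomain hne.1 hne.2
  rw [← hgh, htd] at h3
  rcases (by omega : g.totalDegree = 1 ∧ h.totalDegree = 2 ∨
    h.totalDegree = 1 ∧ g.totalDegree = 2) with ⟨h4, h5⟩ | ⟨h4, h5⟩
  · exact key g h hgh h4 h5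
  · exact key h g (by rw [hgh, mul_comm]) h4 h5

theorem exists_separating_poly {Z Z' : Set P8} (hc : IsProjClosed Z') (hZ : Z' ⊂ Z) :
    ∃ (f : MvPolynomial (Fin 3 × Fin 3) ℂ) (d : ℕ) (X : Mat3) (hX : X ≠ 0), f.IsHomogeneous d ∧
      (∀ x ∈ Z', evalMat f x.rep = 0) ∧ Projectivization.mk ℂ X hX ∈ Z ∧ evalMat f X ≠ 0 := by
  obtain ⟨S, hS, rfl⟩ := hc
  obtain ⟨x, hxZ, hx⟩ := Set.exists_of_ssubset hZ
  simp only [projZeroLocus, Set.mem_ofPred_eq, not_forall] at hx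
  obtain ⟨f, hf, hfx⟩ := hx
  obtain ⟨d, hd⟩ := hS f hf
  exact ⟨f, d, x.rep, x.rep_nonzero, hd, fun y hy => hy f hf, by rwa [x.mk_rep], hfx⟩

theorem mem_of_mk_mem_singularLocus {L : Submodule ℂ Mat3} {X : Mat3} (hX : X ≠ 0)
    (h : Projectivization.mk ℂ X hX ∈ singularLocus L) : X ∈ L ∧ X.det = 0 := by
  obtain ⟨c, hc0, hc⟩ := exists_rep_eq_smul hX
  obtain ⟨h1, h2⟩ := h
  rw [hc] at h1 h2
  refine ⟨(L.smul_mem_iff hc0).1 h1, ?_⟩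
  rw [Matrix.det_smul] at h2
  exact (mul_eq_zero.1 h2).resolve_left (pow_ne_zero _ hc0)

theorem exists_singular_hyperplane_of_isReducibleVariety {L : Submodule ℂ Mat3}
    (h : IsReducibleVariety (singularLocus L)) :
    (∃ X ∈ L, X.det ≠ 0) ∧ ∃ C ≤ L, finrank ℂ C + 1 = finrank ℂ L ∧ ∀ X ∈ C, X.det = 0 := by
  obtain ⟨Z₁, Z₂, hc₁, hc₂, hs₁, hs₂, hZ⟩ := h
  obtain ⟨f₁, d₁, X₁, hX₁, hf₁, hv₁, hm₁, hn₁⟩ := exists_separating_poly hc₁ hs₁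
  obtain ⟨f₂, d₂, X₂, hX₂, hf₂, hv₂, hm₂, hn₂⟩ := exists_separating_poly hc₂ hs₂
  have hX₁L := mem_of_mk_mem_singularLocus hX₁ hm₁
  have hX₂L := mem_of_mk_mem_singularLocus hX₂ hm₂
  have hvan (X : Mat3) (hX : X ∈ L) (hd : X.det = 0) : evalMat (f₁ * f₂) X = 0 := by
    have hne (X : Mat3) (h0 : X ≠ 0) (hX : X ∈ L) (hd : X.det = 0) :
        evalMat (f₁ * f₂) X = 0 := by
      obtain ⟨c, hc0, hc⟩ := exists_rep_eq_smul h0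
      have hmem := mk_mem_singularLocus h0 hX hd
      have : evalMat (f₁ * f₂) (Projectivization.mk ℂ X h0).rep = 0 := by
        rw [evalMat_mul]
        rw [hZ] at hmem
        rcases hmem with hm | hm
        · rw [hv₁ _ hm, zero_mul]
        · rw [hv₂ _ hm, mul_zero]
      rw [hc, evalMat_smul (hf₁.mul hf₂)] at this
      exact (mul_eq_zero.1 this).resolve_left (pow_ne_zero _ hc0)
    -- The zero matrix is no projective point; homogeneity along `0 • X₁` covers it, also in degree
    -- zero.
    by_cases h0 : X = 0
    · have h1 := evalMat_smul (hf₁.mul hf₂) 0 X₁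
      rwa [hne X₁ hX₁ hX₁L.1 hX₁L.2, mul_zero, zero_smul, ← h0] at h1
    · exact hne X h0 hX hd
  let b := finBasis ℂ L
  let e := b.equivFun
  let φ : (Fin (finrank ℂ L) → ℂ) →ₗ[ℂ] Mat3 := L.subtype ∘ₗ e.symm.toLinearMap
  let T : Fin 3 × Fin 3 → MvPolynomial (Fin (finrank ℂ L)) ℂ :=
    fun ij => ∑ k, C ((b k : Mat3) ij.1 ij.2) * X k
  have hT (y : Fin (finrank ℂ L) → ℂ) (f : MvPolynomial (Fin 3 × Fin 3) ℂ) :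
      eval y (aeval T f) = evalMat f (φ y) := by
    have h1 (ij : Fin 3 × Fin 3) : eval y (T ij) = φ y ij.1 ij.2 := by
      simp [T, φ, e, Basis.equivFun_symm_apply, Matrix.sum_apply, mul_comm]
    rw [evalMat, aeval_def, eval_eval₂, ← eval₂_id]
    simp only [h1]
    congr 1
    ext c
    simp
  have hφL (y) : φ y ∈ L := (e.symm y).2
  have hφe (X : L) : φ (e X) = X := by simp [φ]
  have hDhom : (aeval T detPoly).IsHomogeneous 3 := by
    have := isHomogeneous_detPoly.aeval T (n := 1)
      fun ij => IsHomogeneous.sum _ _ _ fun k _ => (isHomogeneous_X ℂ k).C_mul _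
    simpa using this
  have hD (y) : eval y (aeval T detPoly) = (φ y).det := by rw [hT, evalMat_detPoly]
  have hprime : ¬ (Ideal.span {aeval T detPoly}).IsPrime := by
    intro hP
    have hmem : aeval T f₁ * aeval T f₂ ∈ Ideal.span {aeval T detPoly} := by
      -- Nullstellensatz: a prime ideal is the full vanishing ideal of its zero locus.
      rw [← MvPolynomial.IsPrime.vanishingIdeal_zeroLocus (K := ℂ) _ (h := hP), mem_vanishingIdeal_iff]
      intro y hy
      have hy' := hy _ (Ideal.mem_span_singleton_self _)
      rw [aeval_eq_eval] at hy' ⊢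
      rw [← map_mul, hT]
      exact hvan _ (hφL y) (by rw [← hD]; exact hy')
    have hfin {f : MvPolynomial (Fin 3 × Fin 3) ℂ} (hf : aeval T f ∈ Ideal.span {aeval T detPoly})
        {X : Mat3} (hX : X ∈ L ∧ X.det = 0) : evalMat f X = 0 := by
      obtain ⟨q, hq⟩ := Ideal.mem_span_singleton.1 hf
      obtain ⟨y, rfl⟩ : ∃ y, φ y = X := ⟨e ⟨X, hX.1⟩, hφe _⟩
      rw [← hT, hq, map_mul, hD, hX.2, zero_mul]
    rcases hP.mem_or_mem hmem with hm | hm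
    · exact hn₁ (hfin hm hX₁L)
    · exact hn₂ (hfin hm hX₂L)
  -- The zero ideal is prime, so a cubic that vanishes identically is excluded as well.
  have hD0 : aeval T detPoly ≠ 0 := by
    intro h0
    apply hprime
    rw [h0, Ideal.span_singleton_eq_bot.2 rfl]
    exact Ideal.isPrime_bot
  constructor
  · by_contra! hc
    exact hD0 (funext fun y => by rw [hD, hc _ (hφL y), map_zero])
  · obtain ⟨l, hl0, hl⟩ := exists_dual_of_not_prime_cubic hDhom hD0
      fun hp => hprime ((Ideal.span_singleton_prime hD0).2 hp)
    have hinj : Function.Injective φ := L.subtype_injective.comp e.symm.injective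
    refine ⟨(LinearMap.ker l).map φ, ?_, ?_, ?_⟩
    · rintro _ ⟨y, -, rfl⟩
      exact hφL y
    · rw [← (Submodule.equivMapOfInjective φ hinj _).finrank_eq,
        Module.Dual.finrank_ker_add_one_of_ne_zero hl0, finrank_fin_fun]
    · rintro _ ⟨y, hy, rfl⟩
      rw [← hD]
      exact hl y hy

end Epipolar

namespace Epipolar

open Module

/-! ### Products of linear forms -/

section LinearForms

variable {V : Type*} [AddCommGroup V] [Module ℂ V]

/-- A vector space over an infinite field is not a finite union of proper subspaces. -/
theorem exists_forall_eq_zero_of_prod_eq_zero (W : Submodule ℂ V) (f : Fin 3 → Dual ℂ V)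
    (h : ∀ v ∈ W, ∏ i, f i v = 0) : ∃ i, ∀ v ∈ W, f i v = 0 := by
  by_contra! hc
  obtain ⟨v, hv, hne⟩ := Module.Dual.exists_forall_mem_ne_zero_of_forall_exists W f hc
  exact Finset.prod_ne_zero_iff.2 (fun i _ => hne i) (h v hv)

theorem exists_eq_smul_of_ker_le {f g : Dual ℂ V}
    (h : ∀ v, f v = 0 → g v = 0) : ∃ c : ℂ, g = c • f := by
  have := mem_span_of_iInf_ker_le_ker (L := fun _ : Unit => f) (K := g) (by
    rw [iInf_const]; exact h)
  rw [Set.range_const, Submodule.mem_span_singleton] at this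
  obtain ⟨c, hc⟩ := this
  exact ⟨c, hc.symm⟩

/-- If two products of three linear forms are opposite, then both contain a vanishing factor, or
the factors of the first product are proportional to factors of the second. -/
theorem prod_linearForms_dichotomy (f g : Fin 3 → Dual ℂ V)
    (h : ∀ v, ∏ i, f i v + ∏ i, g i v = 0) :
    (∃ r s, f r = 0 ∧ g s = 0) ∨ ∃ (c : Fin 3 → ℂ) (σ : Fin 3 → Fin 3),
      ∀ i, f i = c i • g (σ i) := by
  by_cases hg : ∃ s, g s = 0
  · obtain ⟨s, hs⟩ := hg
    obtain ⟨r, hr⟩ := exists_forall_eq_zero_of_prod_eq_zero ⊤ f fun v _ => by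
      have h1 : ∏ i, g i v = 0 :=
        Finset.prod_eq_zero (Finset.mem_univ s) (by rw [hs, LinearMap.zero_apply])
      rw [← h v, h1, add_zero]
    exact Or.inl ⟨r, s, LinearMap.ext fun v => hr v trivial, hs⟩
  · push Not at hg
    right
    have key (i : Fin 3) : ∃ (c : ℂ) (s : Fin 3), f i = c • g s := by
      obtain ⟨s, hs⟩ := exists_forall_eq_zero_of_prod_eq_zero (LinearMap.ker (f i)) g
        fun v hv => by
          have h1 : ∏ i, f i v = 0 := Finset.prod_eq_zero (Finset.mem_univ i) hv
          rw [← h v, h1, zero_add]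
      obtain ⟨c, hc⟩ := exists_eq_smul_of_ker_le (f := f i) (g := g s) hs
      have hc0 : c ≠ 0 := by
        rintro rfl
        exact hg s (by rw [hc, zero_smul])
      exact ⟨c⁻¹, s, by rw [hc, inv_smul_smul₀ hc0]⟩
    choose c σ hcσ using key
    exact ⟨c, σ, hcσ⟩

theorem surjective_of_injective_of_finrank_le {W : Type*} [AddCommGroup W] [Module ℂ W]
    [FiniteDimensional ℂ V] [FiniteDimensional ℂ W] {φ : V →ₗ[ℂ] W} (hφ : Function.Injective φ)
    (h : finrank ℂ W ≤ finrank ℂ V) : Function.Surjective φ :=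
  (LinearMap.injective_iff_surjective_of_finrank_eq_finrank
    (le_antisymm (LinearMap.finrank_le_finrank_of_injective hφ) h)).1 hφ

/-- A cubic relation `∑ nᵢ rᵢ tᵢ₊₁ tᵢ₊₂ = 0` cannot hold between linear forms on a space of
dimension at least four when `∑ kᵢ tᵢ = 0` and the forms separate points. -/
theorem not_cubic_relation [FiniteDimensional ℂ V] (h4 : 4 ≤ finrank ℂ V)
    (r t : Fin 3 → Dual ℂ V) (n k : Fin 3 → ℂ) (hn : ∀ i, n i ≠ 0) (hk : ∀ i, k i ≠ 0)
    (hsep : ∀ v, (∀ i, r i v = 0) → (∀ i, t i v = 0) → v = 0)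
    (hrel : ∀ v, ∑ i, k i * t i v = 0)
    (hcub : ∀ v, ∑ i, n i * r i v * t (i + 1) v * t (i + 2) v = 0) : False := by
  have hrel' (i : Fin 3) (v : V) : k i * t i v + k (i + 1) * t (i + 1) v +
      k (i + 2) * t (i + 2) v = 0 := by
    rw [← hrel v, Fin.sum_univ_three]
    fin_cases i <;> simp <;> ring
  have hcub' (i : Fin 3) (v : V) : n i * r i v * t (i + 1) v * t (i + 2) v +
      n (i + 1) * r (i + 1) v * t (i + 2) v * t i v +
      n (i + 2) * r (i + 2) v * t i v * t (i + 1) v = 0 := by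
    rw [← hcub v, Fin.sum_univ_three]
    fin_cases i <;> simp <;> ring
  by_cases hA : ∃ i, ∀ v, t i v = 0 → ∀ j, t j v = 0
  · obtain ⟨i, hi⟩ := hA
    have hc (j : Fin 3) : ∃ c : ℂ, t j = c • t i := exists_eq_smul_of_ker_le fun v hv => hi v hv j
    choose c hc using hc
    -- All `t j` are multiples of `t i`. As `dim V ≥ 4`, the values of the `r j` and of `t i` can
    -- then be prescribed freely, so the coefficients of the cubic must vanish.
    let φ : V →ₗ[ℂ] (Fin 3 → ℂ) × ℂ := (LinearMap.pi r).prod (t i)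
    have hφ : Function.Injective φ := by
      rw [← LinearMap.ker_eq_bot, LinearMap.ker_eq_bot']
      intro v hv
      have h1 : ∀ j, r j v = 0 := fun j => congrFun (congrArg Prod.fst hv) j
      exact hsep v h1 (hi v (congrArg Prod.snd hv))
    have hsurj := surjective_of_injective_of_finrank_le hφ (by simpa using h4)
    have hval (x : Fin 3 → ℂ) : n i * x i * c (i + 1) * c (i + 2) +
        n (i + 1) * x (i + 1) * c (i + 2) + n (i + 2) * x (i + 2) * c (i + 1) = 0 := by
      obtain ⟨v, hv⟩ := hsurj (x, 1)
      have h1 : ∀ j, r j v = x j := fun j => congrFun (congrArg Prod.fst hv) j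
      have h2 : t i v = 1 := congrArg Prod.snd hv
      have h3 := hcub' i v
      rw [hc (i + 1), hc (i + 2)] at h3
      simpa [h1, h2] using h3
    have h1 := hval (Pi.single (i + 1) 1)
    have h2 := hval (Pi.single (i + 2) 1)
    have e1 : i ≠ i + 1 := by fin_cases i <;> decide
    have e2 : i ≠ i + 2 := by fin_cases i <;> decide
    have e3 : i + 1 ≠ i + 2 := by fin_cases i <;> decide
    simp only [Pi.single_eq_same, Pi.single_eq_of_ne e1, Pi.single_eq_of_ne e2,
      Pi.single_eq_of_ne e3, Pi.single_eq_of_ne e3.symm, mul_zero, zero_mul, mul_one, zero_add,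
      add_zero, mul_eq_zero, hn, false_or] at h1 h2
    obtain ⟨v, hv⟩ := hsurj (0, 1)
    have h3 : t i v = 1 := congrArg Prod.snd hv
    have h4 := hrel' i v
    rw [hc (i + 1), hc (i + 2), h1, h2] at h4
    simp [h3, hk] at h4
  · push Not at hA
    -- On the kernel of `t i` only the term with `r i` survives, so one of its factors vanishes
    -- there. It is `r i`, since the linear relation would otherwise kill all the `t j` on this
    -- kernel.
    have hB (i : Fin 3) (v : V) (hv : t i v = 0) : r i v = 0 := by
      obtain ⟨s, hs⟩ := exists_forall_eq_zero_of_prod_eq_zero (LinearMap.ker (t i))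
        ![r i, t (i + 1), t (i + 2)] fun w hw => by
          have h1 := hcub' i w
          rw [LinearMap.mem_ker.1 hw, mul_zero, mul_zero, zero_mul, add_zero, add_zero, mul_assoc,
            mul_assoc] at h1
          rw [Fin.prod_univ_three]
          simpa [hn, mul_assoc] using h1
      obtain ⟨w, hw, j, hj⟩ := hA i
      have hall (h : t (i + 1) w = 0 ∨ t (i + 2) w = 0) : False := by
        have h1 := hrel' i w
        have h2 : t (i + 1) w = 0 ∧ t (i + 2) w = 0 := by
          rcases h with h | h <;> simpa [h, hw, hk] using h1
        have h3 : j = i ∨ j = i + 1 ∨ j = i + 2 := by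
          fin_cases i <;> fin_cases j <;> decide
        rcases h3 with rfl | rfl | rfl
        exacts [hj hw, hj h2.1, hj h2.2]
      fin_cases s
      · exact hs v hv
      · exact (hall (Or.inl (hs w hw))).elim
      · exact (hall (Or.inr (hs w hw))).elim
    -- Now `t 0` and `t 1` determine everything, so `V` would have dimension at most two.
    have hinj : Function.Injective (LinearMap.pi ![t 0, t 1] : V →ₗ[ℂ] Fin 2 → ℂ) := by
      rw [← LinearMap.ker_eq_bot, LinearMap.ker_eq_bot']
      intro v hv
      have h0 : t 0 v = 0 := congrFun hv 0
      have h1 : t 1 v = 0 := congrFun hv 1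
      have h2 : t 2 v = 0 := by
        have := hrel' 0 v
        simpa [h0, h1, hk] using this
      have ht (i : Fin 3) : t i v = 0 := by fin_cases i <;> assumption
      exact hsep v (fun i => hB i v (ht i)) ht
    have := LinearMap.finrank_le_finrank_of_injective hinj
    rw [finrank_fin_fun] at this
    omega

end LinearForms

/-! ### Spaces of singular matrices in coordinates -/

/-- Dimension count: `C` lies in the coordinate space of matrices supported off `S` and is large
enough to fill it. -/
theorem single_mem_of_finrank_le {C : Submodule ℂ Mat3} (S : Finset (Fin 3 × Fin 3))
    (hC : 9 ≤ finrank ℂ C + S.card) (hS : ∀ Y ∈ C, ∀ ij ∈ S, Y ij.1 ij.2 = 0)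
    {p q : Fin 3} (hpq : (p, q) ∉ S) : Matrix.single p q 1 ∈ C := by
  let φ : C →ₗ[ℂ] ({ij // ij ∉ S} → ℂ) :=
    LinearMap.pi fun ij => Matrix.entryLinearMap ℂ ℂ ij.1.1 ij.1.2 ∘ₗ C.subtype
  have hφ : Function.Injective φ := by
    rw [← LinearMap.ker_eq_bot, LinearMap.ker_eq_bot']
    intro Y hY
    ext i j
    by_cases hij : (i, j) ∈ S
    · exact hS Y Y.2 _ hij
    · exact congrFun hY ⟨(i, j), hij⟩
  have hcard : Fintype.card {ij // ij ∉ S} + S.card = 9 := by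
    rw [Fintype.card_subtype_compl, Fintype.card_coe]
    have := S.card_le_univ
    simp only [Fintype.card_prod, Fintype.card_fin] at this ⊢
    omega
  obtain ⟨Y, hY⟩ := surjective_of_injective_of_finrank_le hφ
    (by rw [finrank_fintype_fun_eq_card]; omega) (Pi.single ⟨(p, q), hpq⟩ 1)
  have : (Y : Mat3) = Matrix.single p q 1 := by
    ext i j
    by_cases hij : (i, j) ∈ S
    · rw [hS Y Y.2 _ hij, Matrix.single_apply, if_neg]
      rintro ⟨rfl, rfl⟩
      exact hpq hij
    · have h1 : (Y : Mat3) i j = _ := congrFun hY ⟨(i, j), hij⟩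
      rw [h1, Pi.single_apply, Matrix.single_apply]
      simp [eq_comm]
  exact this ▸ Y.2

/-- A space of singular matrices with zero diagonal, orthogonal to the product of two vectors, and
of dimension at least four exists for degenerate pairs of vectors only. -/
theorem degenerate_of_singular_zeroDiagonal {C : Submodule ℂ Mat3} (h4 : 4 ≤ finrank ℂ C)
    (hs : ∀ Y ∈ C, Y.det = 0) (hd : ∀ Y ∈ C, ∀ i, Y i i = 0) (α β : Fin 3 → ℂ)
    (hαβ : ∀ Y ∈ C, β ⬝ᵥ (Y.mulVec α) = 0) :
    (∃ i, ∀ j, j ≠ i → α j = 0) ∨ (∃ i, ∀ j, j ≠ i → β j = 0) ∨ ∃ i, α i = 0 ∧ β i = 0 := by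
  let E (i j : Fin 3) : Dual ℂ C := Matrix.entryLinearMap ℂ ℂ i j ∘ₗ C.subtype
  -- With zero diagonal, only the two 3-cycles contribute to the determinant.
  rcases prod_linearForms_dichotomy (fun i => E i (i + 1)) (fun i => E (i + 1) i) (fun Y => by
    have h1 := hs Y Y.2
    rw [Matrix.det_fin_three, hd Y Y.2, hd Y Y.2, hd Y Y.2] at h1
    simp only [Fin.prod_univ_three]
    simp [E]
    linear_combination h1) with ⟨r, s, hr, hs⟩ | ⟨c, σ, hcσ⟩
  · have hmem {p q : Fin 3} (hpq : p ≠ q) (h1 : (p, q) ≠ (r, r + 1)) (h2 : (p, q) ≠ (s + 1, s)) :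
        β p * α q = 0 := by
      have h3 : Matrix.single p q 1 ∈ C := by
        refine single_mem_of_finrank_le {(0, 0), (1, 1), (2, 2), (r, r + 1), (s + 1, s)} ?_ ?_ ?_
        · have : Finset.card {((0 : Fin 3), (0 : Fin 3)), (1, 1), (2, 2), (r, r + 1), (s + 1, s)}
              = 5 := by fin_cases r <;> fin_cases s <;> rfl
          omega
        · intro Y hY ij hij
          simp only [Finset.mem_insert, Finset.mem_singleton] at hij
          rcases hij with rfl | rfl | rfl | rfl | rfl
          exacts [hd Y hY _, hd Y hY _, hd Y hY _, LinearMap.congr_fun hr ⟨Y, hY⟩,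
            LinearMap.congr_fun hs ⟨Y, hY⟩]
        · simp only [Finset.mem_insert, Finset.mem_singleton, h1, h2, or_false]
          rintro (h | h | h) <;> rw [Prod.mk.injEq] at h <;> exact hpq (h.1.trans h.2.symm)
      have h4 := hαβ _ h3
      rw [Matrix.single_mulVec, one_mul] at h4
      exact (dotProduct_single _ _ p).symm.trans h4
    have h01 := @hmem 0 1
    have h02 := @hmem 0 2
    have h10 := @hmem 1 0
    have h12 := @hmem 1 2
    have h20 := @hmem 2 0
    have h21 := @hmem 2 1
    clear hmem
    simp only [Fin.exists_fin_succ, Fin.forall_fin_succ]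
    -- Four off-diagonal positions remain free, and `β p * α q = 0` at each of them; the rest is
    -- combinatorics.
    fin_cases r <;> fin_cases s <;> simp at h01 h02 h10 h12 h20 h21 ⊢ <;> grind
  · exfalso
    -- One cycle of entries determines the other, so `C` would have dimension at most three.
    let φ : C →ₗ[ℂ] (Fin 3 → ℂ) := LinearMap.pi fun i => E (i + 1) i
    have hφ : Function.Injective φ := by
      rw [← LinearMap.ker_eq_bot, LinearMap.ker_eq_bot']
      intro Y hY
      have h1 (i : Fin 3) : (Y : Mat3) (i + 1) i = 0 := congrFun hY i
      have h2 (i : Fin 3) : (Y : Mat3) i (i + 1) = 0 := by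
        have := LinearMap.congr_fun (hcσ i) Y
        exact this.trans (by simp [E, h1])
      ext i j
      have h3 : j = i ∨ j = i + 1 ∨ i = j + 1 := by
        fin_cases i <;> fin_cases j <;> decide
      rcases h3 with rfl | rfl | rfl
      exacts [hd Y Y.2 _, h2 _, h1 _]
    have := LinearMap.finrank_le_finrank_of_injective hφ
    rw [finrank_fin_fun] at this
    omega

end Epipolar

namespace Epipolar

open Module

/-! ### Frames -/

/-- The matrix of the bilinear form of `X` with respect to the rows of `B` and of `A`. -/
noncomputable def gram (B A : Mat3) : Mat3 →ₗ[ℂ] Mat3 where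
  toFun X := B * X * A.transpose
  map_add' X Y := by rw [Matrix.mul_add, Matrix.add_mul]
  map_smul' c X := by rw [Matrix.mul_smul, Matrix.smul_mul, RingHom.id_apply]

theorem gram_apply (B A X : Mat3) (p q : Fin 3) : gram B A X p q = B p ⬝ᵥ X.mulVec (A q) := by
  change (B * X * A.transpose) p q = _
  rw [Matrix.mul_assoc, Matrix.mul_apply']
  rfl

theorem det_gram (B A X : Mat3) : (gram B A X).det = B.det * X.det * A.det := by
  simp [gram]

theorem gram_injective {B A : Mat3} (hB : B.det ≠ 0) (hA : A.det ≠ 0) :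
    Function.Injective (gram B A) := by
  rw [← LinearMap.ker_eq_bot, LinearMap.ker_eq_bot']
  intro X hX
  have hX : B * X * A.transpose = 0 := hX
  have hA' : IsUnit A.transpose.det := by rw [Matrix.det_transpose]; exact hA.isUnit
  have h1 : B * X = 0 := by
    rw [← Matrix.mul_nonsing_inv_cancel_right _ (B * X) hA', hX, Matrix.zero_mul]
  rw [← Matrix.nonsing_inv_mul_cancel_left B X hB.isUnit, h1, Matrix.mul_zero]

theorem gram_surjective {B A : Mat3} (hB : B.det ≠ 0) (hA : A.det ≠ 0) :
    Function.Surjective (gram B A) :=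
  LinearMap.injective_iff_surjective.1 (gram_injective hB hA)

/-- A vector in coordinates with respect to the rows of an invertible matrix. -/
theorem exists_eq_sum_smul {A : Mat3} (hA : A.det ≠ 0) (x : Fin 3 → ℂ) :
    ∃ α : Fin 3 → ℂ, x = ∑ q, α q • A q := by
  refine ⟨Matrix.vecMul x A⁻¹, ?_⟩
  rw [← Matrix.vecMul_eq_sum, Matrix.vecMul_vecMul, Matrix.nonsing_inv_mul _ hA.isUnit,
    Matrix.vecMul_one]

theorem sum_smul_dotProduct_mulVec (B A X : Mat3) (β α : Fin 3 → ℂ) :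
    (∑ p, β p • B p) ⬝ᵥ X.mulVec (∑ q, α q • A q) = β ⬝ᵥ (gram B A X).mulVec α := by
  have h1 : ∑ p, β p • B p = Matrix.vecMul β B := (Matrix.vecMul_eq_sum _ _).symm
  have h2 : ∑ q, α q • A q = A.transpose.mulVec α := by
    rw [Matrix.mulVec_transpose, Matrix.vecMul_eq_sum]
  rw [h1, h2, ← Matrix.dotProduct_mulVec, Matrix.mulVec_mulVec, Matrix.mulVec_mulVec]
  simp [gram, Matrix.mul_assoc]

/-! ### Frames formed by three of the points -/

section Triples

variable {n : ℕ} {a b : Fin n → Fin 3 → ℂ}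

theorem injective_update {τ : Fin 3 → Fin n} (hτ : Function.Injective τ) {l : Fin n}
    (hl : ∀ q, τ q ≠ l) (q : Fin 3) : Function.Injective (Function.update τ q l) := by
  intro i j hij
  by_cases hi : i = q <;> by_cases hj : j = q
  · rw [hi, hj]
  · subst hi
    rw [Function.update_self, Function.update_of_ne hj] at hij
    exact (hl j hij.symm).elim
  · subst hj
    rw [Function.update_self, Function.update_of_ne hi] at hij
    exact (hl i hij).elim
  · rw [Function.update_of_ne hi, Function.update_of_ne hj] at hij
    exact hτ hij

/-- Cramer's rule: a vanishing coordinate of the extra point detects a degenerate triple. -/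
theorem det_update {τ : Fin 3 → Fin n} {l : Fin n} {α : Fin 3 → ℂ}
    (hα : a l = ∑ q, α q • a (τ q)) (q : Fin 3) :
    (Matrix.of (a ∘ Function.update τ q l)).det = α q * (Matrix.of (a ∘ τ)).det := by
  rw [← smul_eq_mul, ← Matrix.det_updateRow_sum (Matrix.of (a ∘ τ)) q α]
  congr 1
  ext i j
  by_cases hi : i = q
  · subst hi
    simp [hα]
  · simp [hi]

/-- If three of the pairs form frames on both sides, then a space of singular matrices of dimension
at least four that satisfies the epipolar equations forces a triple that is degenerate on both
sides. -/
theorem exists_degenerate_of_frames {C : Submodule ℂ Mat3} (h4 : 4 ≤ finrank ℂ C)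
    (hs : ∀ X ∈ C, X.det = 0) (hC : ∀ X ∈ C, ∀ i, b i ⬝ᵥ X.mulVec (a i) = 0)
    (ha : ∀ i j, i ≠ j → ∀ c : ℂ, a i ≠ c • a j) (hb : ∀ i j, i ≠ j → ∀ c : ℂ, b i ≠ c • b j)
    {τ : Fin 3 → Fin n} (hτ : Function.Injective τ) {l : Fin n} (hl : ∀ q, τ q ≠ l)
    (hA : (Matrix.of (a ∘ τ)).det ≠ 0) (hB : (Matrix.of (b ∘ τ)).det ≠ 0) :
    ∃ σ : Fin 3 → Fin n, Function.Injective σ ∧ (Matrix.of (a ∘ σ)).det = 0 ∧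
      (Matrix.of (b ∘ σ)).det = 0 := by
  obtain ⟨α, hα⟩ := exists_eq_sum_smul hA (a l)
  obtain ⟨β, hβ⟩ := exists_eq_sum_smul hB (b l)
  have hfin : finrank ℂ (C.map (gram (Matrix.of (b ∘ τ)) (Matrix.of (a ∘ τ)))) = finrank ℂ C :=
    ((Submodule.equivMapOfInjective _ (gram_injective hB hA) _).finrank_eq).symm
  have hne {c : Fin n → Fin 3 → ℂ} (hc : ∀ i j, i ≠ j → ∀ x : ℂ, c i ≠ x • c j) {γ : Fin 3 → ℂ}
      (hγ : c l = ∑ q, γ q • c (τ q)) : ¬ ∃ i, ∀ j, j ≠ i → γ j = 0 := by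
    rintro ⟨i, hi⟩
    refine hc l (τ i) (hl i).symm (γ i) (hγ.trans ?_)
    exact Finset.sum_eq_single i (fun j _ hj => by rw [hi j hj, zero_smul]) (by simp)
  have hs' : ∀ Y ∈ C.map (gram (Matrix.of (b ∘ τ)) (Matrix.of (a ∘ τ))), Y.det = 0 := by
    rintro _ ⟨X, hX, rfl⟩
    rw [det_gram, hs X hX, mul_zero, zero_mul]
  have hd : ∀ Y ∈ C.map (gram (Matrix.of (b ∘ τ)) (Matrix.of (a ∘ τ))), ∀ i, Y i i = 0 := by
    rintro _ ⟨X, hX, rfl⟩ i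
    rw [gram_apply]
    exact hC X hX (τ i)
  have hαβ : ∀ Y ∈ C.map (gram (Matrix.of (b ∘ τ)) (Matrix.of (a ∘ τ))),
      β ⬝ᵥ Y.mulVec α = 0 := by
    rintro _ ⟨X, hX, rfl⟩
    have h := hC X hX l
    rw [hα, hβ] at h
    exact (sum_smul_dotProduct_mulVec (Matrix.of (b ∘ τ)) (Matrix.of (a ∘ τ)) X β α).symm.trans h
  rcases degenerate_of_singular_zeroDiagonal (hfin ▸ h4) hs' hd α β hαβ with h | h | ⟨i, hi, hi'⟩
  · exact (hne ha hα h).elim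
  · exact (hne hb hβ h).elim
  · exact ⟨Function.update τ i l, injective_update hτ hl i, by rw [det_update hα, hi, zero_mul],
      by rw [det_update hβ, hi', zero_mul]⟩

/-- The determinants with the standard basis vectors are the coordinates of the cross product of `x`
and `y`. -/
theorem exists_det_ne_zero {x y : Fin 3 → ℂ} (hx : ∀ c : ℂ, x ≠ c • y) (hy : y ≠ 0) :
    ∃ z, (Matrix.of ![x, y, z]).det ≠ 0 := by
  by_contra! hc
  have h0 := hc (Pi.single 0 1)
  have h1 := hc (Pi.single 1 1)
  have h2 := hc (Pi.single 2 1)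
  simp [Matrix.det_fin_three] at h0 h1 h2
  obtain ⟨i, hi⟩ := Function.ne_iff.1 hy
  refine hx (x i / y i) (funext fun j => ?_)
  rw [Pi.zero_apply] at hi
  rw [Pi.smul_apply, smul_eq_mul, div_mul_eq_mul_div, eq_div_iff hi]
  fin_cases i <;> fin_cases j <;> simp <;> grind

theorem eq_zero_of_det_eq_zero {x y z w : Fin 3 → ℂ} {γ : Fin 3 → ℂ}
    (hz : (Matrix.of ![x, y, z]).det ≠ 0) (hw : (Matrix.of ![x, y, w]).det = 0)
    (hγ : w = ∑ p, γ p • (Matrix.of ![x, y, z]) p) : γ 2 = 0 := by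
  have h := Matrix.det_updateRow_sum (Matrix.of ![x, y, z]) 2 γ
  rw [← hγ] at h
  have h1 : (Matrix.of ![x, y, z]).updateRow 2 w = Matrix.of ![x, y, w] := by
    ext i j
    fin_cases i <;> simp [Matrix.updateRow_apply]
  rw [h1, hw, smul_eq_mul, zero_eq_mul] at h
  exact h.resolve_right hz

end Triples

/-- Use three of the `a i` as one frame, and `b 0`, `b 1` with an auxiliary `z` as the other. The
third row of the Gram matrix is unconstrained, the upper two rows reduce to three entries with one
linear relation, and `det` becomes the cubic of `not_cubic_relation`. -/
theorem not_singular_of_general_of_coplanar {a b : Fin 4 → Fin 3 → ℂ} {C : Submodule ℂ Mat3}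
    (h4 : 4 ≤ finrank ℂ C) (hs : ∀ X ∈ C, X.det = 0)
    (hC : ∀ X ∈ C, ∀ i, b i ⬝ᵥ X.mulVec (a i) = 0)
    (hb : ∀ i j, i ≠ j → ∀ c : ℂ, b i ≠ c • b j)
    (ha' : ∀ σ : Fin 3 → Fin 4, Function.Injective σ → (Matrix.of (a ∘ σ)).det ≠ 0)
    (hb' : ∀ σ : Fin 3 → Fin 4, Function.Injective σ → (Matrix.of (b ∘ σ)).det = 0) : False := by
  have hb0 (i : Fin 4) : b i ≠ 0 := fun h => by
    obtain ⟨j, hj⟩ := exists_ne i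
    exact hb i j hj.symm 0 (by rw [h, zero_smul])
  have hτ : Function.Injective (![0, 1, 2] : Fin 3 → Fin 4) := by decide
  have hl : ∀ q, (![0, 1, 2] : Fin 3 → Fin 4) q ≠ 3 := by decide
  have hA := ha' _ hτ
  obtain ⟨α, hα⟩ := exists_eq_sum_smul hA (a 3)
  have hα0 (q : Fin 3) : α q ≠ 0 := fun h => by
    apply ha' _ (injective_update hτ hl q)
    rw [det_update hα, h, zero_mul]
  obtain ⟨z, hB⟩ := exists_det_ne_zero (hb 0 1 (by decide)) (hb0 1)
  obtain ⟨γ, hγ⟩ := exists_eq_sum_smul hB (b 2)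
  obtain ⟨δ, hδ⟩ := exists_eq_sum_smul hB (b 3)
  have hcomp (k : Fin 4) : Matrix.of (b ∘ ![0, 1, k]) = Matrix.of ![b 0, b 1, b k] := by
    ext i j
    fin_cases i <;> rfl
  have hγ2 : γ 2 = 0 := eq_zero_of_det_eq_zero hB (hcomp 2 ▸ hb' _ (by decide)) hγ
  have hδ2 : δ 2 = 0 := eq_zero_of_det_eq_zero hB (hcomp 3 ▸ hb' _ (by decide)) hδ
  have hγs : b 2 = γ 0 • b 0 + γ 1 • b 1 := by
    rw [hγ, Fin.sum_univ_three, hγ2, zero_smul, add_zero]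
    rfl
  have hδs : b 3 = δ 0 • b 0 + δ 1 • b 1 := by
    rw [hδ, Fin.sum_univ_three, hδ2, zero_smul, add_zero]
    rfl
  have hγ0 : γ 0 ≠ 0 := fun h => hb 2 1 (by decide) (γ 1) (by rw [hγs, h, zero_smul, zero_add])
  have hγ1 : γ 1 ≠ 0 := fun h => hb 2 0 (by decide) (γ 0) (by rw [hγs, h, zero_smul, add_zero])
  have hδ0 : δ 0 ≠ 0 := fun h => hb 3 1 (by decide) (δ 1) (by rw [hδs, h, zero_smul, zero_add])
  have hδ1 : δ 1 ≠ 0 := fun h => hb 3 0 (by decide) (δ 0) (by rw [hδs, h, zero_smul, add_zero])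
  have hγδ : δ 0 * γ 1 - δ 1 * γ 0 ≠ 0 := fun h => hb 3 2 (by decide) (δ 0 / γ 0) (by
    rw [hγs, hδs, smul_add, smul_smul, smul_smul, div_mul_cancel₀ _ hγ0, div_mul_eq_mul_div,
      sub_eq_zero.1 h, mul_div_cancel_right₀ _ hγ0])
  set A : Mat3 := Matrix.of (a ∘ ![0, 1, 2]) with hAdef
  set B : Mat3 := Matrix.of ![b 0, b 1, z] with hBdef
  let E (i j : Fin 3) : Dual ℂ C := Matrix.entryLinearMap ℂ ℂ i j ∘ₗ gram B A ∘ₗ C.subtype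
  have hE (i j : Fin 3) (X : C) : E i j X = gram B A X i j := rfl
  have h00 (X : C) : gram B A X 0 0 = 0 := by rw [gram_apply]; exact hC X X.2 0
  have h11 (X : C) : gram B A X 1 1 = 0 := by rw [gram_apply]; exact hC X X.2 1
  have h2 (X : C) : γ 0 * gram B A X 0 2 + γ 1 * gram B A X 1 2 = 0 := by
    have h := hC X X.2 2
    rw [hγs, add_dotProduct, smul_dotProduct, smul_dotProduct] at h
    simp only [gram_apply]
    exact h
  have h3 (X : C) : δ 0 * (α 0 * gram B A X 0 0 + α 1 * gram B A X 0 1 + α 2 * gram B A X 0 2) +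
      δ 1 * (α 0 * gram B A X 1 0 + α 1 * gram B A X 1 1 + α 2 * gram B A X 1 2) = 0 := by
    have h := hC X X.2 3
    rw [hδ, hα, sum_smul_dotProduct_mulVec] at h
    simp only [Matrix.mulVec, dotProduct, Fin.sum_univ_three, hδ2] at h
    linear_combination h
  have ht2 (X : C) : gram B A X 1 2 = -γ 0 * (γ 1)⁻¹ * gram B A X 0 2 := by
    field_simp
    linear_combination h2 X
  -- The scaling by `(γ 1)⁻¹` makes entries `(0, 2)` and `(1, 2)` equal to `γ 1` and `-γ 0` times
  -- the last form, whence the coefficients `-γ 0, γ 1, -1` of the determinant; the other list comes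
  -- from the fourth pair.
  refine not_cubic_relation h4 (fun i => E 2 i) ![E 1 0, E 0 1, (γ 1)⁻¹ • E 0 2]
    ![-γ 0, γ 1, -1] ![δ 1 * α 0, δ 0 * α 1, α 2 * (δ 0 * γ 1 - δ 1 * γ 0)] ?_ ?_ ?_ ?_ ?_
  · intro i
    fin_cases i <;> simp [hγ0, hγ1]
  · intro i
    fin_cases i <;> simp [hα0, hδ0, hδ1, hγδ]
  · intro X hr ht
    have t0 : gram B A X 1 0 = 0 := ht 0
    have t1 : gram B A X 0 1 = 0 := ht 1
    have t2 : gram B A X 0 2 = 0 := by simpa [hE, hγ1] using ht 2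
    have t3 : gram B A X 1 2 = 0 := by rw [ht2, t2, mul_zero]
    apply Subtype.ext
    apply gram_injective hB hA
    rw [ZeroMemClass.coe_zero, map_zero]
    ext i j
    fin_cases i
    · fin_cases j
      exacts [h00 X, t1, t2]
    · fin_cases j
      exacts [t0, h11 X, t3]
    · exact hr j
  · intro X
    have h := h3 X
    rw [h00, h11, ht2] at h
    simp only [Fin.sum_univ_three, Matrix.cons_val, hE, LinearMap.smul_apply, smul_eq_mul]
    field_simp at h ⊢
    linear_combination h
  · intro X
    have h : (gram B A X).det = 0 := by rw [det_gram, hs X X.2, mul_zero, zero_mul]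
    rw [Matrix.det_fin_three, h00, h11, ht2] at h
    simp [Fin.sum_univ_three, hE] 
    field_simp at h ⊢
    linear_combination h

/-- Both remaining vectors lie in the plane of `c i` and `c j`, so the cross product of these two
annihilates all four. -/
theorem det_eq_zero_of_coplanar {c : Fin 4 → Fin 3 → ℂ}
    (hc : ∀ i j, i ≠ j → ∀ x : ℂ, c i ≠ x • c j) {i j k l : Fin 4} (hij : i ≠ j)
    (hall : ∀ x, x = i ∨ x = j ∨ x = k ∨ x = l) (hk : (Matrix.of (c ∘ ![i, j, k])).det = 0)
    (hl : (Matrix.of (c ∘ ![i, j, l])).det = 0) (σ : Fin 3 → Fin 4) :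
    (Matrix.of (c ∘ σ)).det = 0 := by
  obtain ⟨z, hz⟩ := exists_det_ne_zero (hc i j hij) fun h => hc j i hij.symm 0 (by
    rw [h, zero_smul])
  let w : Fin 3 → ℂ := crossProduct (c i) (c j)
  have hw (x : Fin 3 → ℂ) : x ⬝ᵥ w = (Matrix.of ![c i, c j, x]).det := by
    simp [w, cross_apply, Matrix.det_fin_three, dotProduct, Fin.sum_univ_three]
    ring
  have hcomp (k : Fin 4) : Matrix.of (c ∘ ![i, j, k]) = Matrix.of ![c i, c j, c k] := by
    ext i j
    fin_cases i <;> rfl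
  rw [hcomp, ← hw] at hk hl
  refine Matrix.exists_mulVec_eq_zero_iff.1 ⟨w, fun h => hz ?_, funext fun p => ?_⟩
  · rw [← hw, h, dotProduct_zero]
  · change c (σ p) ⬝ᵥ w = 0
    rcases hall (σ p) with h | h | h | h <;> rw [h]
    · exact dot_self_cross _ _
    · exact dot_cross_self _ _
    · exact hk
    · exact hl

/-- A singular space of matrices of dimension at least four that satisfies the epipolar equations
of four point pairs exists only if three of the pairs are collinear on both sides. -/
theorem exists_collinear_triple {a b : Fin 4 → Fin 3 → ℂ} {C : Submodule ℂ Mat3}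
    (h4 : 4 ≤ finrank ℂ C) (hs : ∀ X ∈ C, X.det = 0)
    (hC : ∀ X ∈ C, ∀ i, b i ⬝ᵥ X.mulVec (a i) = 0)
    (ha : ∀ i j, i ≠ j → ∀ c : ℂ, a i ≠ c • a j) (hb : ∀ i j, i ≠ j → ∀ c : ℂ, b i ≠ c • b j) :
    ∃ σ : Fin 3 → Fin 4, Function.Injective σ ∧ (Matrix.of (a ∘ σ)).det = 0 ∧
      (Matrix.of (b ∘ σ)).det = 0 := by
  by_contra! hno
  have hor (σ : Fin 3 → Fin 4) (hσ : Function.Injective σ) :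
      (Matrix.of (a ∘ σ)).det = 0 ∨ (Matrix.of (b ∘ σ)).det = 0 := by
    by_contra! hne
    have hns : ¬ Function.Surjective σ := fun h => by
      simpa using Fintype.card_le_of_surjective σ h
    obtain ⟨l, hl⟩ := not_forall.1 hns
    obtain ⟨ρ, hρ, h1, h2⟩ := exists_degenerate_of_frames h4 hs hC ha hb hσ
      (fun q hq => hl ⟨q, hq⟩) hne.1 hne.2
    exact hno ρ hρ h1 h2
  -- Transposition exchanges the two sides.
  have hacop (h : ∀ σ, (Matrix.of (a ∘ σ)).det = 0) : False := by
    refine not_singular_of_general_of_coplanar (a := b) (b := a)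
      (C := C.map (Matrix.transposeLinearEquiv (Fin 3) (Fin 3) ℂ ℂ).toLinearMap) ?_ ?_ ?_ ha
      (fun σ hσ => hno σ hσ (h σ)) (fun σ _ => h σ)
    · rwa [LinearEquiv.finrank_map_eq]
    · rintro _ ⟨X, hX, rfl⟩
      exact (Matrix.det_transpose X).trans (hs X hX)
    · rintro _ ⟨X, hX, rfl⟩ i
      change a i ⬝ᵥ X.transpose.mulVec (b i) = 0
      rw [Matrix.mulVec_transpose, dotProduct_comm, ← Matrix.dotProduct_mulVec]
      exact hC X hX i
  have hbcop (h : ∀ σ, (Matrix.of (b ∘ σ)).det = 0) : False :=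
    not_singular_of_general_of_coplanar h4 hs hC hb
      (fun σ hσ hσ' => hno σ hσ hσ' (h σ)) (fun σ _ => h σ)
  have hpair {i j k l : Fin 4} (hij : i ≠ j) (hall : ∀ x, x = i ∨ x = j ∨ x = k ∨ x = l) :
      ¬ ((Matrix.of (a ∘ ![i, j, k])).det = 0 ∧ (Matrix.of (a ∘ ![i, j, l])).det = 0) ∧
      ¬ ((Matrix.of (b ∘ ![i, j, k])).det = 0 ∧ (Matrix.of (b ∘ ![i, j, l])).det = 0) :=
    ⟨fun h => hacop (det_eq_zero_of_coplanar ha hij hall h.1 h.2),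
      fun h => hbcop (det_eq_zero_of_coplanar hb hij hall h.1 h.2)⟩
  have hswap (c : Fin 4 → Fin 3 → ℂ) (i j k : Fin 4)
      (h : (Matrix.of (c ∘ ![i, j, k])).det = 0) : (Matrix.of (c ∘ ![i, k, j])).det = 0 := by
    simp [Matrix.det_fin_three] at h ⊢
    linear_combination -h
  have p1 := hpair (i := 0) (j := 1) (k := 2) (l := 3) (by decide) (by decide)
  have p2 := hpair (i := 0) (j := 2) (k := 1) (l := 3) (by decide) (by decide)
  have p3 := hpair (i := 0) (j := 3) (k := 1) (l := 2) (by decide) (by decide)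
  -- Two of these three triples degenerate on the same side, and any two share two indices.
  have o1 := hor ![0, 1, 2] (by decide)
  have o2 := hor ![0, 1, 3] (by decide)
  have o3 := hor ![0, 2, 3] (by decide)
  have sa := hswap a
  have sb := hswap b
  rcases o1 with o1 | o1 <;> rcases o2 with o2 | o2 <;> rcases o3 with o3 | o3
  exacts [p1.1 ⟨o1, o2⟩, p1.1 ⟨o1, o2⟩, p2.1 ⟨sa _ _ _ o1, o3⟩, p3.2 ⟨sb _ _ _ o2, sb _ _ _ o3⟩,
    p3.1 ⟨sa _ _ _ o2, sa _ _ _ o3⟩, p2.2 ⟨sb _ _ _ o1, o3⟩, p1.2 ⟨o1, o2⟩, p1.2 ⟨o1, o2⟩]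

end Epipolar

namespace Epipolar

open Module MvPolynomial

/-! ### A collinear triple makes the variety reducible -/

theorem two_le_rank_of_linearIndependent {Y : Mat3} {x y : Fin 3 → ℂ}
    (h : LinearIndependent ℂ ![Y.mulVec x, Y.mulVec y]) : 2 ≤ Y.rank := by
  have h1 := finrank_span_eq_card h
  rw [Fintype.card_fin] at h1
  refine h1.symm.le.trans (Submodule.finrank_mono (Submodule.span_le.2 ?_))
  rintro _ ⟨i, rfl⟩
  fin_cases i
  exacts [⟨x, rfl⟩, ⟨y, rfl⟩]

/-- A quaternary quadratic form of full rank does not vanish on any hyperplane. -/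
theorem exists_quadric_ne_zero (p : Fin 4 → ℂ) {κ : ℂ} (hκ : κ ≠ 0) :
    ∃ x₁ x₂ y₁ y₂ : ℂ, p 0 * x₁ + p 1 * x₂ + p 2 * y₁ + p 3 * y₂ = 0 ∧
      x₂ * y₁ + κ * (x₁ * y₂) ≠ 0 := by
  by_cases h1 : p 1 = 0 <;> by_cases h2 : p 2 = 0
  · exact ⟨0, 1, 1, 0, by simp [h1, h2], by simp⟩
  · by_cases h0 : p 0 = 0
    · by_cases h3 : p 3 = 0
      · exact ⟨1, 0, 0, 1, by simp [h0, h3], by simpa using hκ⟩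
      · exact ⟨0, 1, -p 3, p 2, by rw [h1]; ring, by simpa using h3⟩
    · by_cases h3 : p 3 = 0
      · exact ⟨-p 2, 1, p 0, 0, by rw [h1]; ring, by simpa using h0⟩
      · exact ⟨p 3, 0, 0, -p 0, by ring, by simp [hκ, h0, h3]⟩
  · by_cases h0 : p 0 = 0
    · by_cases h3 : p 3 = 0
      · exact ⟨1, 0, 0, 1, by simp [h0, h3], by simpa using hκ⟩
      · exact ⟨0, -p 3, 1, p 1, by rw [h2]; ring, by simpa using h3⟩
    · by_cases h3 : p 3 = 0
      · exact ⟨-p 1, p 0, 1, 0, by rw [h2]; ring, by simpa using h0⟩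
      · exact ⟨p 3, 0, 0, -p 0, by ring, by simp [hκ, h0, h3]⟩
  · exact ⟨0, p 2, -p 1, 0, by ring, by simp [h1, h2]⟩

/-- A coordinate of a matrix with respect to two frames. -/
noncomputable def gramEntry (B A : Mat3) (p q : Fin 3) : Dual ℂ Mat3 :=
  Matrix.entryLinearMap ℂ ℂ p q ∘ₗ gram B A

/-- The quadratic factor of the determinant, in the coordinates given by two frames. -/
noncomputable def quadricPoly (B A : Mat3) (κ : ℂ) : MvPolynomial (Fin 3 × Fin 3) ℂ :=
  linearPoly (gramEntry B A 1 2) * linearPoly (gramEntry B A 2 0) +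
    C κ * (linearPoly (gramEntry B A 0 2) * linearPoly (gramEntry B A 2 1)) -
    C κ * (linearPoly (gramEntry B A 0 1) * linearPoly (gramEntry B A 2 2))

theorem evalMat_quadricPoly (B A : Mat3) (κ : ℂ) (X : Mat3) :
    evalMat (quadricPoly B A κ) X = gram B A X 1 2 * gram B A X 2 0 +
      κ * (gram B A X 0 2 * gram B A X 2 1) - κ * (gram B A X 0 1 * gram B A X 2 2) := by
  have h (p q : Fin 3) := evalMat_linearPoly (gramEntry B A p q) X
  simp only [evalMat, quadricPoly, map_add, map_sub, map_mul, eval_C] at h ⊢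
  simp only [h]
  rfl

theorem isHomogeneous_quadricPoly (B A : Mat3) (κ : ℂ) : (quadricPoly B A κ).IsHomogeneous 2 :=
  (((isHomogeneous_linearPoly _).mul (isHomogeneous_linearPoly _)).add
    (((isHomogeneous_linearPoly _).mul (isHomogeneous_linearPoly _)).C_mul _)).sub
    (((isHomogeneous_linearPoly _).mul (isHomogeneous_linearPoly _)).C_mul _)

/-- A linear space of matrices that is given, in suitable frames, by two zeros on the diagonal, an
antidiagonal relation in the upper left block, and one more bilinear equation. -/
def IsBlockSpace (L : Submodule ℂ Mat3) (B A : Mat3) (κ : ℂ) (ν μ : Fin 3 → ℂ) : Prop :=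
  ∀ X, X ∈ L ↔ gram B A X 0 0 = 0 ∧ gram B A X 1 1 = 0 ∧
    gram B A X 1 0 = κ * gram B A X 0 1 ∧ ν ⬝ᵥ (gram B A X).mulVec μ = 0

/-! ### The determinant splits on a block space -/

section Block

variable {L : Submodule ℂ Mat3} {B A : Mat3} {κ : ℂ} {ν μ : Fin 3 → ℂ}

theorem IsBlockSpace.det_gram_eq (h : IsBlockSpace L B A κ ν μ) {X : Mat3} (hX : X ∈ L) :
    (gram B A X).det = gram B A X 0 1 * evalMat (quadricPoly B A κ) X := by
  obtain ⟨h0, h1, h2, -⟩ := (h X).1 hX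
  rw [Matrix.det_fin_three, h0, h1, h2, evalMat_quadricPoly]
  ring

theorem IsBlockSpace.det_eq_zero_iff (h : IsBlockSpace L B A κ ν μ) (hB : B.det ≠ 0)
    (hA : A.det ≠ 0) {X : Mat3} (hX : X ∈ L) :
    X.det = 0 ↔ gram B A X 0 1 = 0 ∨ evalMat (quadricPoly B A κ) X = 0 := by
  rw [← mul_eq_zero, ← h.det_gram_eq hX, det_gram]
  simp [hA, hB]

/-- `N` lives in the border of the block. The quadric has rank four there, so the single equation
left by `ν` and `μ` cannot make it vanish. Thus `N` shows that the hyperplane is not inside the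
quadric and contains rank two. -/
theorem IsBlockSpace.exists_mem (h : IsBlockSpace L B A κ ν μ) (hB : B.det ≠ 0)
    (hA : A.det ≠ 0) (hκ : κ ≠ 0) : ∃ N ∈ L, gram B A N 0 1 = 0 ∧ gram B A N 2 2 = 0 ∧
      evalMat (quadricPoly B A κ) N ≠ 0 ∧ 2 ≤ N.rank := by
  obtain ⟨x₁, x₂, y₁, y₂, hlin, hq⟩ := exists_quadric_ne_zero
    ![ν 0 * μ 2, ν 1 * μ 2, ν 2 * μ 0, ν 2 * μ 1] hκ
  obtain ⟨N, hN⟩ := gram_surjective hB hA !![0, 0, x₁; 0, 0, x₂; y₁, y₂, 0]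
  refine ⟨N, (h N).2 ?_, ?_, ?_, ?_, ?_⟩
  · simp only [hN]
    refine ⟨by simp, by simp, by simp, ?_⟩
    simp [Matrix.mulVec, dotProduct, Fin.sum_univ_three] at hlin ⊢
    linear_combination hlin
  · simp [hN]
  · simp [hN]
  · rw [evalMat_quadricPoly, hN]
    simpa using hq
  · have h1 : (gram B A N).rank ≤ N.rank :=
      (Matrix.rank_mul_le_left (B * N) A.transpose).trans (Matrix.rank_mul_le_right B N)
    refine le_trans ?_ h1
    rw [hN]
    rcases (by
      rw [← mul_ne_zero_iff, ← mul_ne_zero_iff]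
      by_contra! hc
      exact hq (by rw [hc.1, hc.2, mul_zero, add_zero]) :
        (x₂ ≠ 0 ∧ y₁ ≠ 0) ∨ (x₁ ≠ 0 ∧ y₂ ≠ 0)) with
      ⟨hx, hy⟩ | ⟨hx, hy⟩
    · refine two_le_rank_of_linearIndependent (x := ![0, 0, 1]) (y := ![1, 0, 0]) ?_
      rw [LinearIndependent.pair_iff]
      intro s t hst
      have e1 := congrFun hst 1
      have e2 := congrFun hst 2
      simp [hx, hy] at e1 e2
      exact ⟨e1, e2⟩
    · refine two_le_rank_of_linearIndependent (x := ![0, 0, 1]) (y := ![0, 1, 0]) ?_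
      rw [LinearIndependent.pair_iff]
      intro s t hst
      have e1 := congrFun hst 0
      have e2 := congrFun hst 2
      simp [hx, hy] at e1 e2
      exact ⟨e1, e2⟩

theorem IsBlockSpace.isReducibleVariety (h : IsBlockSpace L B A κ ν μ) (hB : B.det ≠ 0)
    (hA : A.det ≠ 0) (hκ : κ ≠ 0) (hreg : ∃ X ∈ L, X.det ≠ 0) :
    IsReducibleVariety (singularLocus L) := by
  obtain ⟨N, hNL, hN1, hN2, hNq, -⟩ := h.exists_mem hB hA hκ
  have hlin := isProjClosed_setOf_evalMat (isHomogeneous_linearPoly (gramEntry B A 0 1))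
  have hquad := isProjClosed_setOf_evalMat (isHomogeneous_quadricPoly B A κ)
  refine ⟨_, _, (isProjClosed_singularLocus L).inter hlin,
    (isProjClosed_singularLocus L).inter hquad, ?_, ?_, ?_⟩
  · obtain ⟨X, hX, hdet⟩ := hreg
    have hX1 : gram B A X 0 1 ≠ 0 := fun h0 => hdet ((h.det_eq_zero_iff hB hA hX).2 (Or.inl h0))
    -- Move a regular `X` along `N` until it meets the quadric: entry `(0, 1)` stays nonzero, and
    -- the leading coefficient in `s` is the value at `N`. The `κ`-term with entries `(0, 1)` and
    -- `(2, 2)` gives no cross term, as both vanish at `N`.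
    obtain ⟨r, hr⟩ := IsAlgClosed.exists_pow_nat_eq (discrim (evalMat (quadricPoly B A κ) N)
      (gram B A X 1 2 * gram B A N 2 0 + gram B A N 1 2 * gram B A X 2 0 +
        κ * (gram B A X 0 2 * gram B A N 2 1 + gram B A N 0 2 * gram B A X 2 1))
      (evalMat (quadricPoly B A κ) X)) (n := 2) (by norm_num)
    obtain ⟨s, hs⟩ := exists_quadratic_eq_zero hNq ⟨r, by rw [← hr, sq]⟩
    have hY1 : gram B A (X + s • N) 0 1 = gram B A X 0 1 := by simp [hN1]
    have hYL : X + s • N ∈ L := L.add_mem hX (L.smul_mem s hNL)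
    have hYq : evalMat (quadricPoly B A κ) (X + s • N) = 0 := by
      rw [← hs]
      simp only [evalMat_quadricPoly, map_add, map_smul, Matrix.add_apply, Matrix.smul_apply,
        smul_eq_mul, hN1, hN2]
      ring
    have hY0 : X + s • N ≠ 0 := fun h0 => hX1 (by rw [← hY1, h0]; simp)
    have hmem := mk_mem_singularLocus hY0 hYL ((h.det_eq_zero_iff hB hA hYL).2 (Or.inr hYq))
    refine Set.inter_ssubset_left_iff.2 fun hsub => ?_
    have h1 := hsub hmem
    obtain ⟨c, hc0, hc⟩ := exists_rep_eq_smul hY0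
    rw [Set.mem_ofPred_eq, hc, evalMat_smul (isHomogeneous_linearPoly _), evalMat_linearPoly] at h1
    rcases mul_eq_zero.1 h1 with h1 | h1
    · exact pow_ne_zero _ hc0 h1
    · exact hX1 (hY1.symm.trans h1)
  · have hN0 : N ≠ 0 := by
      rintro rfl
      exact hNq (by simp [evalMat_quadricPoly])
    have hmem := mk_mem_singularLocus hN0 hNL ((h.det_eq_zero_iff hB hA hNL).2 (Or.inl hN1))
    refine Set.inter_ssubset_left_iff.2 fun hsub => ?_
    have h1 := hsub hmem
    obtain ⟨c, hc0, hc⟩ := exists_rep_eq_smul hN0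
    rw [Set.mem_ofPred_eq, hc, evalMat_smul (isHomogeneous_quadricPoly B A κ)] at h1
    exact (mul_ne_zero (pow_ne_zero _ hc0) hNq) h1
  · rw [← Set.inter_union_distrib_left, eq_comm, Set.inter_eq_left]
    intro x hx
    rcases (h.det_eq_zero_iff hB hA hx.1).1 hx.2 with h1 | h1
    · exact Or.inl ((evalMat_linearPoly _ _).trans h1)
    · exact Or.inr h1

theorem IsBlockSpace.containsCodimOneCompressionSpace (h : IsBlockSpace L B A κ ν μ)
    (hB : B.det ≠ 0) (hA : A.det ≠ 0) (hκ : κ ≠ 0) (hreg : ∃ X ∈ L, X.det ≠ 0) :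
    ContainsCodimOneCompressionSpace L := by
  obtain ⟨N, hNL, hN1, -, -, hN2⟩ := h.exists_mem hB hA hκ
  let l : Dual ℂ L := gramEntry B A 0 1 ∘ₗ L.subtype
  have hl : l ≠ 0 := by
    obtain ⟨X, hX, hdet⟩ := hreg
    intro h0
    exact hdet ((h.det_eq_zero_iff hB hA hX).2 (Or.inl (LinearMap.congr_fun h0 ⟨X, hX⟩)))
  have hdet {X : Mat3} (hX : X ∈ L) (h1 : gram B A X 0 1 = 0) : X.rank ≤ 2 :=
    (rank_le_two_iff X).2 ((h.det_eq_zero_iff hB hA hX).2 (Or.inl h1))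
  have hAi : LinearIndependent ℂ A.row := Matrix.linearIndependent_rows_of_det_ne_zero hA
  -- On this hyperplane the upper left block is zero: the plane of `A 0`, `A 1` is sent into the
  -- line annihilated by `B 0` and `B 1`.
  refine ⟨(LinearMap.ker l).map L.subtype, 2, le_rfl, ⟨⟨?_, ?_⟩, 1, 1,
    Submodule.span ℂ (Set.range ![A 0, A 1]),
    Submodule.span ℂ {B⁻¹.mulVec (Pi.single 2 1)}, rfl, ?_, ?_, ?_⟩, ?_, ?_⟩
  · exact ⟨N, ⟨⟨N, hNL⟩, hN1, rfl⟩, le_antisymm (hdet hNL hN1) hN2⟩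
  · rintro _ ⟨_, ⟨X, hX, rfl⟩, rfl⟩
    exact hdet X.2 hX
  · have h2 : LinearIndependent ℂ ![A 0, A 1] := by
      have h3 := hAi.comp ![0, 1] (by decide)
      convert h3 using 1
      ext i
      fin_cases i <;> rfl
    rw [finrank_span_eq_card h2, Fintype.card_fin]
  · refine finrank_span_singleton fun h0 => ?_
    have h1 := congrArg B.mulVec h0
    rw [Matrix.mulVec_mulVec, Matrix.mul_nonsing_inv _ hB.isUnit, Matrix.one_mulVec,
      Matrix.mulVec_zero] at h1
    simpa using congrFun h1 2
  · rintro _ ⟨X, hX, rfl⟩ x hx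
    obtain ⟨h00, h11, h10, -⟩ := (h X).1 X.2
    have h01 : gram B A X 0 1 = 0 := hX
    rw [h01, mul_zero] at h10
    rw [gram_apply] at h00 h01 h10 h11
    have hx' : B 0 ⬝ᵥ (X : Mat3).mulVec x = 0 ∧ B 1 ⬝ᵥ (X : Mat3).mulVec x = 0 := by
      induction hx using Submodule.span_induction with
      | mem x hx =>
        obtain ⟨i, rfl⟩ := hx
        fin_cases i
        exacts [⟨h00, h10⟩, ⟨h01, h11⟩]
      | zero => simp
      | add x y _ _ h1 h2 => simp [Matrix.mulVec_add, h1, h2]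
      | smul c x _ h1 => simp [Matrix.mulVec_smul, h1]
    refine Submodule.mem_span_singleton.2 ⟨B 2 ⬝ᵥ (X : Mat3).mulVec x, ?_⟩
    have h1 : B.mulVec ((X : Mat3).mulVec x) =
        (B 2 ⬝ᵥ (X : Mat3).mulVec x) • (Pi.single 2 1 : Fin 3 → ℂ) := by
      ext i
      fin_cases i
      · exact hx'.1.trans (by simp)
      · exact hx'.2.trans (by simp)
      · simp [Matrix.mulVec]
    rw [← Matrix.mulVec_smul, ← h1, Matrix.mulVec_mulVec, Matrix.nonsing_inv_mul _ hB.isUnit,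
      Matrix.one_mulVec]
    rfl
  · rintro _ ⟨X, -, rfl⟩
    exact X.2
  · rw [Submodule.finrank_map_subtype_eq, Module.Dual.finrank_ker_add_one_of_ne_zero hl]

end Block

theorem exists_isBlockSpace {a b : Fin 4 → Fin 3 → ℂ} {L : Submodule ℂ Mat3}
    (hL : ∀ X, X ∈ L ↔ ∀ i, b i ⬝ᵥ X.mulVec (a i) = 0)
    (ha : ∀ i j, i ≠ j → ∀ c : ℂ, a i ≠ c • a j) (hb : ∀ i j, i ≠ j → ∀ c : ℂ, b i ≠ c • b j)
    {σ : Fin 3 → Fin 4} (hσ : Function.Injective σ) (haσ : (Matrix.of (a ∘ σ)).det = 0)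
    (hbσ : (Matrix.of (b ∘ σ)).det = 0) :
    ∃ (B A : Mat3) (κ : ℂ) (ν μ : Fin 3 → ℂ), B.det ≠ 0 ∧ A.det ≠ 0 ∧ κ ≠ 0 ∧
      IsBlockSpace L B A κ ν μ := by
  have h01 : σ 0 ≠ σ 1 := hσ.ne (by decide)
  have h20 : σ 2 ≠ σ 0 := hσ.ne (by decide)
  have h21 : σ 2 ≠ σ 1 := hσ.ne (by decide)
  have hframe {c : Fin 4 → Fin 3 → ℂ} (hc : ∀ i j, i ≠ j → ∀ x : ℂ, c i ≠ x • c j)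
      (hcσ : (Matrix.of (c ∘ σ)).det = 0) : ∃ (A : Mat3) (α : Fin 3 → ℂ), A.det ≠ 0 ∧
        A 0 = c (σ 0) ∧ A 1 = c (σ 1) ∧ α 0 ≠ 0 ∧ α 1 ≠ 0 ∧ α 2 = 0 ∧
        c (σ 2) = ∑ q, α q • A q := by
    obtain ⟨z, hz⟩ := exists_det_ne_zero (hc _ _ h01) fun h => hc _ _ h01.symm 0 (by
      rw [h, zero_smul])
    obtain ⟨α, hα⟩ := exists_eq_sum_smul hz (c (σ 2))
    have hcomp : Matrix.of (c ∘ σ) = Matrix.of ![c (σ 0), c (σ 1), c (σ 2)] := by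
      ext i j
      fin_cases i <;> rfl
    have hα2 := eq_zero_of_det_eq_zero hz (hcomp ▸ hcσ) hα
    have hα' : c (σ 2) = α 0 • c (σ 0) + α 1 • c (σ 1) := by
      rw [hα, Fin.sum_univ_three, hα2, zero_smul, add_zero]
      rfl
    refine ⟨_, α, hz, rfl, rfl, fun h => ?_, fun h => ?_, hα2, hα⟩
    · exact hc _ _ h21 (α 1) (by rw [hα', h, zero_smul, zero_add])
    · exact hc _ _ h20 (α 0) (by rw [hα', h, zero_smul, add_zero])
  obtain ⟨A, α, hA, hA0, hA1, hα0, hα1, hα2, hα⟩ := hframe ha haσ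
  obtain ⟨B, β, hB, hB0, hB1, hβ0, hβ1, hβ2, hβ⟩ := hframe hb hbσ
  obtain ⟨l, hl⟩ : ∃ l, ∀ i, i = σ 0 ∨ i = σ 1 ∨ i = σ 2 ∨ i = l := by
    generalize σ 0 = i, σ 1 = j, σ 2 = k at h01 h20 h21
    revert i j k
    decide
  obtain ⟨μ, hμ⟩ := exists_eq_sum_smul hA (a l)
  obtain ⟨ν, hν⟩ := exists_eq_sum_smul hB (b l)
  -- With zero diagonal, the third pair says `β 0 * α 1 * Y 0 1 + β 1 * α 0 * Y 1 0 = 0` for the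
  -- Gram matrix `Y`.
  refine ⟨B, A, -(β 0 * α 1) / (β 1 * α 0), ν, μ, hB, hA, ?_, fun X => ?_⟩
  · exact div_ne_zero (neg_ne_zero.2 (mul_ne_zero hβ0 hα1)) (mul_ne_zero hβ1 hα0)
  · have hall : X ∈ L ↔ b (σ 0) ⬝ᵥ X.mulVec (a (σ 0)) = 0 ∧ b (σ 1) ⬝ᵥ X.mulVec (a (σ 1)) = 0 ∧
        b (σ 2) ⬝ᵥ X.mulVec (a (σ 2)) = 0 ∧ b l ⬝ᵥ X.mulVec (a l) = 0 := by
      rw [hL]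
      refine ⟨fun h => ⟨h _, h _, h _, h _⟩, fun ⟨h0, h1, h2, h3⟩ i => ?_⟩
      rcases hl i with rfl | rfl | rfl | rfl <;> assumption
    rw [hall, ← hA0, ← hB0, ← hA1, ← hB1, ← gram_apply, ← gram_apply, hμ, hν,
      sum_smul_dotProduct_mulVec, hα, hβ, sum_smul_dotProduct_mulVec]
    refine and_congr_right fun h0 => and_congr_right fun h1 => and_congr_left fun _ => ?_
    rw [div_mul_eq_mul_div, eq_div_iff (mul_ne_zero hβ1 hα0)]
    simp only [Matrix.mulVec, dotProduct, Fin.sum_univ_three, hα2, hβ2, h0, h1]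
    constructor <;> intro h <;> linear_combination h

/-! ### Point pairs -/

/-- The last coordinate one forces `c = 1`. -/
theorem homogenize_ne_smul {n : ℕ} {u : Fin n → Fin 2 → ℝ} (hu : Function.Injective u)
    {i j : Fin n} (hij : i ≠ j) (c : ℂ) : homogenize (u i) ≠ c • homogenize (u j) := by
  intro h
  have h0 := congrFun h 0
  have h1 := congrFun h 1
  have h2 := congrFun h 2
  simp [homogenize] at h0 h1 h2
  rw [← h2, one_mul] at h0 h1
  apply hij
  apply hu
  ext k
  fin_cases k
  · exact_mod_cast h0
  · exact_mod_cast h1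

theorem collinear_of_det_eq_zero {p q r : Fin 2 → ℝ}
    (h : (Matrix.of ![homogenize p, homogenize q, homogenize r]).det = 0) :
    Collinear ℝ {p, q, r} := by
  have h' : (p 0 * q 1 - p 0 * r 1 - p 1 * q 0 + p 1 * r 0 + q 0 * r 1 - q 1 * r 0 : ℝ) = 0 := by
    simp [Matrix.det_fin_three, homogenize] at h
    have : ((p 0 * q 1 - p 0 * r 1 - p 1 * q 0 + p 1 * r 0 + q 0 * r 1 - q 1 * r 0 : ℝ) : ℂ)
        = 0 := by
      push_cast
      linear_combination h
    exact_mod_cast this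
  by_cases hpq : p = q
  · subst hpq
    simpa using collinear_pair ℝ p r
  rw [collinear_iff_of_mem (p₀ := p) (by simp)]
  refine ⟨q - p, ?_⟩
  intro x hx
  simp only [Set.mem_insert_iff, Set.mem_singleton_iff] at hx
  rcases hx with rfl | rfl | rfl
  · exact ⟨0, by simp⟩
  · exact ⟨1, by simp⟩
  · by_cases h0 : q 0 - p 0 = 0
    · have h1 : q 1 - p 1 ≠ 0 := fun h1 => hpq (by
        ext k
        fin_cases k
        · exact (sub_eq_zero.1 h0).symm
        · exact (sub_eq_zero.1 h1).symm)
      refine ⟨(x 1 - p 1) / (q 1 - p 1), funext fun k => ?_⟩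
      fin_cases k
      · simp
        field_simp
        linear_combination -h'
      · simp
        field_simp
        ring
    · refine ⟨(x 0 - p 0) / (q 0 - p 0), funext fun k => ?_⟩
      fin_cases k
      · simp
        field_simp
        ring
      · simp
        field_simp
        linear_combination h'

theorem mem_epipolarSpace {k : ℕ} {u v : Fin k → Fin 2 → ℝ} {X : Mat3} :
    X ∈ epipolarSpace u v ↔ ∀ i, homogenize (v i) ⬝ᵥ X.mulVec (homogenize (u i)) = 0 := Iff.rfl

theorem five_le_finrank_epipolarSpace (u v : Fin 4 → Fin 2 → ℝ) :
    5 ≤ finrank ℂ (epipolarSpace u v) := by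
  let φ : Mat3 →ₗ[ℂ] (Fin 4 → ℂ) :=
    { toFun := fun X i => homogenize (v i) ⬝ᵥ X.mulVec (homogenize (u i))
      map_add' := fun X Y => funext fun i => by
        simp [Matrix.add_mulVec]
      map_smul' := fun c X => funext fun i => by
        simp [Matrix.smul_mulVec] }
  have h1 : epipolarSpace u v = LinearMap.ker φ := by
    ext X
    rw [mem_epipolarSpace, LinearMap.mem_ker]
    exact funext_iff.symm
  have h2 := φ.finrank_range_add_finrank_ker
  have h3 := (LinearMap.range φ).finrank_le
  rw [finrank_matrix, finrank_self, Fintype.card_fin] at h2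
  rw [finrank_fin_fun] at h3
  rw [h1]
  omega

end Epipolar

/-! ### The main theorem -/

theorem mainTheorem7 (u v : Fin 4 → Fin 2 → ℝ)
    (hu : Function.Injective u) (hv : Function.Injective v) :
    ((∀ i j k : Fin 4, i ≠ j → i ≠ k → j ≠ k →
        ¬ Collinear ℝ {u i, u j, u k} ∨ ¬ Collinear ℝ {v i, v j, v k}) →
      Epipolar.IsIrreducibleVariety (Epipolar.epipolarVariety u v)) ∧
    (Epipolar.IsReducibleVariety (Epipolar.epipolarVariety u v) ↔
      ¬ Epipolar.projEpipolarSpace u v ⊆ Epipolar.rankAtMostTwo ∧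
        Epipolar.ContainsCodimOneCompressionSpace (Epipolar.epipolarSpace u v)) := by
  open Epipolar Module in
  have hdim := five_le_finrank_epipolarSpace u v
  have ha : ∀ i j, i ≠ j → ∀ c : ℂ, (homogenize ∘ u) i ≠ c • (homogenize ∘ u) j :=
    fun i j hij c => homogenize_ne_smul hu hij c
  have hb : ∀ i j, i ≠ j → ∀ c : ℂ, (homogenize ∘ v) i ≠ c • (homogenize ∘ v) j :=
    fun i j hij c => homogenize_ne_smul hv hij c
  -- The bound `5 ≤ dim L` gives `C` the dimension four that the triple lemma needs.
  have htriple {C : Submodule ℂ Mat3} (hC : C ≤ epipolarSpace u v)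
      (hfin : finrank ℂ C + 1 = finrank ℂ (epipolarSpace u v)) (hs : ∀ X ∈ C, X.det = 0) :=
    exists_collinear_triple (by omega) hs (fun X hX i => hC hX i) ha hb
  have hreg : ¬ projEpipolarSpace u v ⊆ rankAtMostTwo ↔ ∃ X ∈ epipolarSpace u v, X.det ≠ 0 := by
    constructor
    · intro h
      obtain ⟨x, hx, hr⟩ := Set.not_subset.1 h
      exact ⟨x.rep, hx, fun hd => hr ((rank_le_two_iff _).2 hd)⟩
    · rintro ⟨X, hX, hd⟩ hsub
      have hX0 : X ≠ 0 := by
        rintro rfl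
        exact hd (by simp)
      obtain ⟨c, hc0, hc⟩ := exists_rep_eq_smul hX0
      have hmem : Projectivization.mk ℂ X hX0 ∈ projEpipolarSpace u v :=
        show (Projectivization.mk ℂ X hX0).rep ∈ _ from
          hc ▸ (epipolarSpace u v).smul_mem c hX
      have h1 := (rank_le_two_iff _).1 (hsub hmem)
      rw [hc, Matrix.det_smul] at h1
      exact mul_ne_zero (pow_ne_zero _ hc0) hd h1
  rw [hreg, epipolarVariety_eq]
  refine ⟨fun hcol => ?_, fun hred => ?_, fun ⟨hX, hC⟩ => ?_⟩
  · refine isIrreducibleVariety_of_not_isReducibleVariety (isProjClosed_singularLocus _)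
      (singularLocus_nonempty (by omega)) fun hred => ?_
    obtain ⟨-, C, hC, hfin, hs⟩ := exists_singular_hyperplane_of_isReducibleVariety hred
    obtain ⟨σ, hσ, h1, h2⟩ := htriple hC hfin hs
    have hcomp (w : Fin 4 → Fin 2 → ℝ) : Matrix.of ((fun i => homogenize (w i)) ∘ σ) =
        Matrix.of ![homogenize (w (σ 0)), homogenize (w (σ 1)), homogenize (w (σ 2))] := by
      ext i j
      fin_cases i <;> rfl
    rw [hcomp] at h1 h2
    rcases hcol (σ 0) (σ 1) (σ 2) (hσ.ne (by decide)) (hσ.ne (by decide)) (hσ.ne (by decide))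
      with h | h
    · exact h (collinear_of_det_eq_zero h1)
    · exact h (collinear_of_det_eq_zero h2)
  · obtain ⟨hX, C, hC, hfin, hs⟩ := exists_singular_hyperplane_of_isReducibleVariety hred
    obtain ⟨σ, hσ, h1, h2⟩ := htriple hC hfin hs
    obtain ⟨B, A, κ, ν, μ, hB, hA, hκ, hbl⟩ :=
      exists_isBlockSpace (fun X => mem_epipolarSpace) ha hb hσ h1 h2
    exact ⟨hX, hbl.containsCodimOneCompressionSpace hB hA hκ hX⟩
  -- Rank at most two makes `C` a singular hyperplane, which already yields the triple and hence the
  -- block form.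
  · obtain ⟨C, k, hk, ⟨hmax, -⟩, hCL, hfin⟩ := hC
    obtain ⟨σ, hσ, h1, h2⟩ := htriple hCL hfin fun X hXC =>
      (rank_le_two_iff X).1 ((hmax.2 ⟨X, hXC, rfl⟩).trans hk)
    obtain ⟨B, A, κ, ν, μ, hB, hA, hκ, hbl⟩ :=
      exists_isBlockSpace (fun X => mem_epipolarSpace) ha hb hσ h1 h2
    exact hbl.isReducibleVariety hB hA hκ hX
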